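/- Let $D=[0,1]$ and $[s]=\{1,\dots,s\}$. For $\mathfrak{u}\subseteq[s]$ write $D^{\mathfrak u}$ for the cube of points $x_{\mathfrak u}=(x_j)_{j\in\mathfrak u}$, write $[x_{\mathfrak u};t_{\mathfrak u^c}]\in D^s$ for the point with coordinates $x_j$ ($j\in\mathfrak u$) and $t_j$ ($j\notin\mathfrak u$), and let $f^{(\mathfrak u)}=\prod_{j\in\mathfrak u}\frac{\partial}{\partial x_j}f$ be the (weak) mixed derivative. Fix $p\in(1,\infty)$ with conjugate exponent $p^*$, $\frac1p+\frac1{p^*}=1$. Given non-negative weights $\gamma=(\gamma_{\mathfrak u})_{\mathfrak u\subseteq[s]}$, let $\mathfrak U=\{\mathfrak u\subseteq[s]:\gamma_{\mathfrak u}>0\}$. The anchored space $F_{s,p,\gamma}$ consists of all functions $$f(x)=\sum_{\mathfrak u\in\mathfrak U}\int_{D^{\mathfrak u}}h_{\mathfrak u}(t)\prod_{j\in\mathfrak u}\mathbf 1_{[0,x_j)}(t_j)\,dt,\qquad h_{\mathfrak u}\in L_p(D^{\mathfrak u}),$$ with norm $$\|f\|_{F_{s,p,\gamma}}=\Big(\sum_{\mathfrak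 u\in\mathfrak U}\gamma_{\mathfrak u}^{-p}\,\big\|f^{(\mathfrak u)}([\cdot_{\mathfrak u};0_{\mathfrak u^c}])\big\|_{L_p(D^{\mathfrak u})}^p\Big)^{1/p}.$$ The ANOVA space $H_{s,p,\gamma}$ consists of all functions $$f(x)=\sum_{\mathfrak u\in\mathfrak U}\int_{D^{\mathfrak u}}g_{\mathfrak u}(t)\prod_{j\in\mathfrak u}\big(\mathbf 1_{[0,x_j)}(t_j)-(1-t_j)\big)\,dt,\qquad g_{\mathfrak u}\in L_p(D^{\mathfrak u}),$$ with norm $$\|f\|_{H_{s,p,\gamma}}=\Big(\sum_{\mathfrak u\in\mathfrak U}\gamma_{\mathfrak u}^{-p}\,\Big\|\int_{D^{\mathfrak u^c}}f^{(\mathfrak u)}([\cdot_{\mathfrak u};t_{\mathfrak u^c}])\,dt_{\mathfrak u^c}\Big\|_{L_p(D^{\mathfrak u})}^p\Big)^{1/p}.$$ Fix $\omega>0$ and an integer $q\ge0$, and for every $s$ consider the finite order weights $\gamma_{\mathfrak u}=\omega^{|\mathfrak u|}$ if $|\mathfrak u|\le q$ and $\gamma_{\mathfrak u}=0$ if $|\mathfrak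 u|>q$. Then for every $s$ we have $F_{s,p,\gamma}\subseteq H_{s,p,\gamma}$, the embedding $\imath:F_{s,p,\gamma}\hookrightarrow H_{s,p,\gamma}$, $\imath(f)=f$, is bounded, and its operator norm satisfies $$\|\imath\|_{F_{s,p,\gamma}\hookrightarrow H_{s,p,\gamma}}=\Theta\big(s^{q/p^*}\big)\qquad\text{as } s\to\infty,$$ where the implied constants may depend on $p$, $q$ and $\omega$ but not on $s$. -/

import Mathlib

open MeasureTheory Filter
open scoped NNReal ENNReal Asymptotics unitInterval

noncomputable section

namespace WeightedSpaces

/-! Functions of `s` variables are functions on `D^s = Fin s → I`, where `D = I = [0,1]`; for a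
set `u` of coordinates, `D^u = u → I`. Both carry the product Lebesgue measure `volume`. -/

/-- The partial derivative of `φ` with respect to the coordinate `j`. -/
def partialDeriv {ι : Type} [Fintype ι] [DecidableEq ι] (j : ι) (φ : (ι → ℝ) → ℝ) :
    (ι → ℝ) → ℝ :=
  fun x => fderiv ℝ φ x (Pi.single j 1)

/-- The mixed partial derivative of order one in each coordinate of `u`. It is applied only to
smooth functions, so that the order of the differentiations does not matter. -/
def mixedPartial {ι : Type} [Fintype ι] [LinearOrder ι] (u : Finset ι) (φ : (ι → ℝ) → ℝ) :
    (ι → ℝ) → ℝ :=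
  (u.sort (· ≤ ·)).foldr partialDeriv φ

/-- Test functions on the open unit cube. -/
def IsTestFunction {ι : Type} [Fintype ι] (φ : (ι → ℝ) → ℝ) : Prop :=
  ContDiff ℝ (⊤ : ℕ∞) φ ∧ HasCompactSupport φ ∧
    tsupport φ ⊆ Set.univ.pi fun _ : ι => Set.Ioo (0 : ℝ) 1

/-- `g` is the weak (distributional) mixed derivative `f^{(u)} = ∏_{j ∈ u} ∂/∂x_j f` of `f` on the
unit cube. -/
def IsWeakMixedDeriv {ι : Type} [Fintype ι] [LinearOrder ι] (u : Finset ι)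
    (f g : (ι → I) → ℝ) : Prop :=
  Integrable f volume ∧ Integrable g volume ∧
    ∀ φ : (ι → ℝ) → ℝ, IsTestFunction φ →
      ∫ x : ι → I, f x * mixedPartial u φ (fun j => (x j : ℝ)) =
        (-1) ^ u.card * ∫ x : ι → I, g x * φ (fun j => (x j : ℝ))

open Classical in
/-- The weak mixed derivative `f^{(u)}`; it is determined up to a null set whenever it exists. -/
def weakMixedDeriv {ι : Type} [Fintype ι] [LinearOrder ι] (u : Finset ι)
    (f : (ι → I) → ℝ) : (ι → I) → ℝ :=
  if h : ∃ g, IsWeakMixedDeriv u f g then h.choose else 0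

/-- The point `[x_u; t_{uᶜ}]`, whose coordinates in `u` are those of `x` and whose other coordinates
are those of `t`. -/
def glue {s : ℕ} (u : Finset (Fin s)) (x : u → I) (t : {j // j ∉ u} → I) : Fin s → I :=
  fun j => if h : j ∈ u then x ⟨j, h⟩ else t ⟨j, h⟩

/-- `T_u(h)(x) = ∫_{D^u} h(t) ∏_{j ∈ u} 1_{[0,x_j)}(t_j) dt`. -/
def anchoredOp {s : ℕ} (u : Finset (Fin s)) (h : (u → I) → ℝ) : (Fin s → I) → ℝ :=
  fun x => ∫ t : u → I, h t * ∏ j : u, (Set.Ico (0 : I) (x j)).indicator (fun _ => (1 : ℝ)) (t j)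

/-- `∫_{D^u} g(t) ∏_{j ∈ u} (1_{[0,x_j)}(t_j) - (1 - t_j)) dt`. -/
def anovaOp {s : ℕ} (u : Finset (Fin s)) (g : (u → I) → ℝ) : (Fin s → I) → ℝ :=
  fun x => ∫ t : u → I, g t *
    ∏ j : u, ((Set.Ico (0 : I) (x j)).indicator (fun _ => (1 : ℝ)) (t j) - (1 - (t j : ℝ)))

/-- The anchored space `F_{s,p,γ}`: the functions `∑_{u : γ_u > 0} T_u(h_u)` with
`h_u ∈ L_p(D^u)`. -/
def anchoredSpace {s : ℕ} (p : ℝ) (γ : Finset (Fin s) → ℝ≥0) : Set ((Fin s → I) → ℝ) :=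
  {f | ∃ h : (u : Finset (Fin s)) → (u → I) → ℝ,
    (∀ u, MemLp (h u) (ENNReal.ofReal p) volume) ∧
      ∀ x, f x = ∑ u with 0 < γ u, anchoredOp u (h u) x}

/-- The ANOVA space `H_{s,p,γ}`. -/
def anovaSpace {s : ℕ} (p : ℝ) (γ : Finset (Fin s) → ℝ≥0) : Set ((Fin s → I) → ℝ) :=
  {f | ∃ g : (u : Finset (Fin s)) → (u → I) → ℝ,
    (∀ u, MemLp (g u) (ENNReal.ofReal p) volume) ∧
      ∀ x, f x = ∑ u with 0 < γ u, anovaOp u (g u) x}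

/-- `f^{(u)}([·_u; 0_{uᶜ}])`, as a function on `D^u`: the derivative in all the variables
`x_u` of `x_u ↦ f([x_u; 0_{uᶜ}])`. -/
def anchoredDeriv {s : ℕ} (f : (Fin s → I) → ℝ) (u : Finset (Fin s)) : (u → I) → ℝ :=
  weakMixedDeriv Finset.univ fun x : u → I => f (glue u x fun _ => 0)

/-- `∫_{D^{uᶜ}} f^{(u)}([·_u; t_{uᶜ}]) dt_{uᶜ}`, as a function on `D^u`. -/
def anovaDeriv {s : ℕ} (f : (Fin s → I) → ℝ) (u : Finset (Fin s)) : (u → I) → ℝ :=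
  fun x => ∫ t : {j // j ∉ u} → I, weakMixedDeriv u f (glue u x t)

/-- The norm of the anchored space,
`(∑_{u : γ_u > 0} γ_u^{-p} ‖f^{(u)}([·_u; 0_{uᶜ}])‖_{L_p}^p)^{1/p}`. -/
def anchoredNorm {s : ℕ} (p : ℝ) (γ : Finset (Fin s) → ℝ≥0) (f : (Fin s → I) → ℝ) : ℝ≥0∞ :=
  (∑ u with 0 < γ u, (γ u : ℝ≥0∞) ^ (-p) *
    eLpNorm (anchoredDeriv f u) (ENNReal.ofReal p) volume ^ p) ^ (1 / p)

/-- The norm of the ANOVA space,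
`(∑_{u : γ_u > 0} γ_u^{-p} ‖∫_{D^{uᶜ}} f^{(u)}([·_u; t_{uᶜ}]) dt_{uᶜ}‖_{L_p}^p)^{1/p}`. -/
def anovaNorm {s : ℕ} (p : ℝ) (γ : Finset (Fin s) → ℝ≥0) (f : (Fin s → I) → ℝ) : ℝ≥0∞ :=
  (∑ u with 0 < γ u, (γ u : ℝ≥0∞) ^ (-p) *
    eLpNorm (anovaDeriv f u) (ENNReal.ofReal p) volume ^ p) ^ (1 / p)

/-- The operator norm of the embedding `f ↦ f` of the anchored space into the ANOVA space. -/
def embeddingNorm {s : ℕ} (p : ℝ) (γ : Finset (Fin s) → ℝ≥0) : ℝ≥0∞ :=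
  ⨆ f ∈ {f ∈ anchoredSpace p γ | anchoredNorm p γ f ≤ 1}, anovaNorm p γ f

/-- Finite order weights of order `q`: `γ_u = ω^{|u|}` if `|u| ≤ q`, and `γ_u = 0` otherwise. -/
def finiteOrderWeights (ω : ℝ≥0) (q s : ℕ) (u : Finset (Fin s)) : ℝ≥0 :=
  if u.card ≤ q then ω ^ u.card else 0

end WeightedSpaces

end

/-! Let `f = ∑ T_v(h_v)`. Differentiating once in each variable of `u` removes the step kernels of
`T_v` indexed by `u` if `u ⊆ v`, and kills `T_v(h_v)` otherwise. Anchoring at `0` leaves only `h_u`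
(`anchoredDeriv_ae_eq`), so the anchored norm is a weighted `ℓ_p` norm of the numbers `‖h_u‖_p`.
Integrating over `D^{uᶜ}` instead leaves contributions of all `v ⊇ u`, and since the kernels lie in
`[0,1]`, the `u`-term of the ANOVA norm is at most `∑_{v ⊇ u} ‖h_v‖_p` (`eLpNorm_anovaDeriv_le`).

Upper bound: a sum of `N` terms satisfies `(∑ a_v)^p ≤ N^(p-1) ∑ a_v^p`, and here `N ≤ (s+1)^q`.
After the sums over `u` and `v` are exchanged, each `v` is counted at most `2^q` times, and passing
from `γ_u` to `γ_v` costs a constant. The `p`-th root gives `s^(q(p-1)/p) = s^(q/p*)`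
(`anovaNorm_le`).

Lower bound: take `h_u` equal to one constant for `|u| = q` and zero otherwise. The integral of `f`,
which is the `u = ∅` part of the ANOVA norm, already has the right size (`le_toReal_embeddingNorm`).

Inclusion: write `1_{[0,x)}(t) = (1_{[0,x)}(t) - (1-t)) + (1-t)` and expand the product over the
coordinates (`anchoredOp_eq_sum_anovaOp`). -/

namespace WeightedSpaces

/-! ### Measure-preserving maps between cubes -/

section MeasurePreserving

variable {ι κ : Type} [Fintype ι] [DecidableEq ι] [Fintype κ]

/-- Resampling one coordinate preserves the product measure. -/
lemma measurePreserving_update (j : ι) :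
    MeasurePreserving (fun z : (ι → I) × I => Function.update z.1 j z.2) := by
  have hm : Measurable (fun z : (ι → I) × I => Function.update z.1 j z.2) := by
    refine measurable_pi_lambda _ fun i => ?_
    by_cases h : i = j
    · subst h; simpa using measurable_snd
    · simp only [Function.update_of_ne h]
      exact (measurable_pi_apply i).comp measurable_fst
  refine ⟨hm, Eq.symm (Measure.pi_eq fun s hs => ?_)⟩
  rw [Measure.map_apply hm (MeasurableSet.univ_pi hs)]
  have : (fun z : (ι → I) × I => Function.update z.1 j z.2) ⁻¹' (Set.univ.pi s) =
      (Set.univ.pi (Function.update s j Set.univ)) ×ˢ s j := by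
    ext ⟨x, τ⟩
    simp only [Set.mem_preimage, Set.mem_pi, Set.mem_univ, true_imp_iff, Set.mem_prod]
    constructor
    · intro h
      refine ⟨fun i => ?_, by simpa using h j⟩
      by_cases hi : i = j
      · subst hi; simp
      · simpa [hi] using h i
    · rintro ⟨h1, h2⟩ i
      by_cases hi : i = j
      · subst hi; simpa using h2
      · simpa [hi] using h1 i
  rw [this, Measure.volume_eq_prod, Measure.prod_prod, volume_pi, Measure.pi_pi,
    ← Finset.mul_prod_erase _ _ (Finset.mem_univ j),
    ← Finset.mul_prod_erase (a := j) _ (fun i => volume (s i)) (Finset.mem_univ j)]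
  simp only [Function.update_self, measure_univ, one_mul]
  rw [mul_comm]
  congr 1
  refine Finset.prod_congr rfl fun i hi => ?_
  rw [Function.update_of_ne (Finset.ne_of_mem_erase hi)]

/-- Restriction to, and relabelling of, some of the coordinates preserves the product measure. -/
lemma measurePreserving_comp_injective {e : κ → ι} (he : Function.Injective e) :
    MeasurePreserving (fun x : ι → I => fun k => x (e k)) := by
  have hm : Measurable (fun x : ι → I => fun k => x (e k)) :=
    measurable_pi_lambda _ fun k => measurable_pi_apply _
  refine ⟨hm, Eq.symm (Measure.pi_eq fun s hs => ?_)⟩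
  rw [Measure.map_apply hm (MeasurableSet.univ_pi hs)]
  have : (fun x : ι → I => fun k => x (e k)) ⁻¹' (Set.univ.pi s) =
      Set.univ.pi (Function.extend e s fun _ => Set.univ) := by
    ext x
    simp only [Set.mem_preimage, Set.mem_pi, Set.mem_univ, true_imp_iff]
    constructor
    · intro h i
      by_cases hi : ∃ k, e k = i
      · obtain ⟨k, rfl⟩ := hi
        rw [he.extend_apply]; exact h k
      · rw [Function.extend_apply' _ _ _ hi]; trivial
    · intro h k
      have := h (e k)
      rwa [he.extend_apply] at this
  rw [this, volume_pi, Measure.pi_pi]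
  refine (Fintype.prod_of_injective e he _ _ (fun i hi => ?_) fun k => ?_).symm
  · rw [Function.extend_apply' _ _ _ (by simpa using hi)]; simp
  · rw [he.extend_apply]

/-- Exchanging the coordinates outside `u` of two independent points preserves the measure. -/
lemma measurePreserving_piecewise_pair (u : Finset ι) :
    MeasurePreserving (fun z : (ι → I) × (ι → I) =>
      (u.piecewise z.1 z.2, u.piecewise z.2 z.1)) := by
  have h1 := volume_measurePreserving_arrowProdEquivProdArrow I I ι
  have h2 : MeasurePreserving
      (fun (a : ι → I × I) i => (if i ∈ u then id else Prod.swap : I × I → I × I) (a i)) := by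
    refine volume_preserving_pi fun i => ?_
    by_cases h : i ∈ u
    · simpa [h] using MeasurePreserving.id _
    · simp only [h, if_false]
      exact Measure.measurePreserving_swap (μ := (volume : Measure I)) (ν := (volume : Measure I))
  have h3 := (h1.comp h2).comp h1.symm
  convert h3 using 1
  ext z i
  · by_cases h : i ∈ u <;>
      simp [h, MeasurableEquiv.arrowProdEquivProdArrow, Equiv.arrowProdEquivProdArrow]
  · by_cases h : i ∈ u <;>
      simp [h, MeasurableEquiv.arrowProdEquivProdArrow, Equiv.arrowProdEquivProdArrow]

lemma measurePreserving_piecewise (u : Finset ι) :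
    MeasurePreserving (fun z : (ι → I) × (ι → I) => u.piecewise z.1 z.2) :=
  measurePreserving_fst.comp (measurePreserving_piecewise_pair u)

/-- Integration by parts in `x_j` evaluates the test function at `t_j`; this swap then restores the
test function at `x` and moves `x_j` into the density. -/
lemma measurePreserving_swap_coord (j : ι) :
    MeasurePreserving (fun z : (ι → I) × (ι → I) =>
      (Function.update z.1 j (z.2 j), Function.update z.2 j (z.1 j))) := by
  have h := (measurePreserving_piecewise_pair ({j} : Finset ι)).comp
    (Measure.measurePreserving_swap (μ := (volume : Measure (ι → I)))
      (ν := (volume : Measure (ι → I))))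
  simp only [Function.comp_def, Finset.piecewise_singleton, Prod.fst_swap, Prod.snd_swap] at h
  exact h

lemma measurePreserving_glue {s : ℕ} (u : Finset (Fin s)) :
    MeasurePreserving (fun z : (u → I) × ({j // j ∉ u} → I) => glue u z.1 z.2) := by
  have h := (volume_preserving_piEquivPiSubtypeProd (fun _ : Fin s => I) (· ∈ u)).symm
  convert h
  rfl

end MeasurePreserving

/-- Averaging over one of two independent variables does not increase the `L^p` norm. -/
lemma eLpNorm_integral_prod_right_le {α β : Type} [MeasurableSpace α] [MeasurableSpace β]
    {μ : Measure α} {ν : Measure β} [SFinite μ] [IsProbabilityMeasure ν] {F : α × β → ℝ}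
    (hF : AEStronglyMeasurable F (μ.prod ν)) {p : ℝ} (hp : 1 ≤ p) :
    eLpNorm (fun a => ∫ b, F (a, b) ∂ν) (ENNReal.ofReal p) μ ≤
      eLpNorm F (ENNReal.ofReal p) (μ.prod ν) := by
  have hp0 : 0 < p := by linarith
  have hne : ENNReal.ofReal p ≠ 0 := by simpa using hp0
  rw [eLpNorm_eq_lintegral_rpow_enorm_toReal hne ENNReal.ofReal_ne_top,
    eLpNorm_eq_lintegral_rpow_enorm_toReal hne ENNReal.ofReal_ne_top, ENNReal.toReal_ofReal hp0.le]
  refine ENNReal.rpow_le_rpow ?_ (by positivity)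
  rw [lintegral_prod _ (hF.enorm.pow_const p)]
  refine lintegral_mono_ae ?_
  filter_upwards [hF.prodMk_left] with a ha
  have h1 : ‖∫ b, F (a, b) ∂ν‖ₑ ≤ eLpNorm (fun b => F (a, b)) 1 ν := by
    rw [eLpNorm_one_eq_lintegral_enorm]
    exact enorm_integral_le_lintegral_enorm _
  -- Jensen's inequality, in the form `L^1 ≤ L^p` on a probability space.
  have h2 : eLpNorm (fun b => F (a, b)) 1 ν ≤ eLpNorm (fun b => F (a, b)) (ENNReal.ofReal p) ν :=
    eLpNorm_le_eLpNorm_of_exponent_le (by simpa using hp) ha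
  refine (ENNReal.rpow_le_rpow (h1.trans h2) hp0.le).trans ?_
  rw [eLpNorm_eq_lintegral_rpow_enorm_toReal hne ENNReal.ofReal_ne_top, ENNReal.toReal_ofReal hp0.le,
    ← ENNReal.rpow_mul, one_div, inv_mul_cancel₀ hp0.ne', ENNReal.rpow_one]

/-! ### Test functions and uniqueness of weak derivatives -/

section TestFunctions

variable {ι : Type} [Fintype ι]

lemma IsTestFunction.eq_zero {φ : (ι → ℝ) → ℝ} (hφ : IsTestFunction φ) {y : ι → ℝ} {j : ι}
    (hy : y j ∉ Set.Ioo (0 : ℝ) 1) : φ y = 0 := by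
  by_contra h
  exact hy (hφ.2.2 (subset_tsupport φ h) j trivial)

lemma IsTestFunction.partialDeriv [DecidableEq ι] {φ : (ι → ℝ) → ℝ} (hφ : IsTestFunction φ)
    (j : ι) : IsTestFunction (partialDeriv j φ) := by
  refine ⟨?_, hφ.2.1.fderiv_apply ℝ _, (tsupport_fderiv_apply_subset ℝ _).trans hφ.2.2⟩
  exact (hφ.1.fderiv_right (m := ((⊤ : ℕ∞) : WithTop ℕ∞)) (by norm_cast)).clm_apply contDiff_const

lemma IsTestFunction.foldr [DecidableEq ι] {φ : (ι → ℝ) → ℝ} (hφ : IsTestFunction φ)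
    (l : List ι) : IsTestFunction (l.foldr WeightedSpaces.partialDeriv φ) := by
  induction l with
  | nil => exact hφ
  | cons j l ih => exact ih.partialDeriv j

/-- The restriction to the unit cube of a function on `ℝ^ι`. -/
abbrev onCube (φ : (ι → ℝ) → ℝ) : (ι → I) → ℝ := fun x => φ fun j => (x j : ℝ)

omit [Fintype ι] in
lemma continuous_coe_cube : Continuous (fun (x : ι → I) j => (x j : ℝ)) :=
  continuous_pi fun j => continuous_subtype_val.comp (continuous_apply j)

lemma IsTestFunction.continuous_onCube {φ : (ι → ℝ) → ℝ} (hφ : IsTestFunction φ) :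
    Continuous (onCube φ) := hφ.1.continuous.comp continuous_coe_cube

lemma IsTestFunction.exists_bound {φ : (ι → ℝ) → ℝ} (hφ : IsTestFunction φ) :
    ∃ C, ∀ x, ‖onCube φ x‖ ≤ C := by
  obtain ⟨C, hC⟩ := hφ.2.1.exists_bound_of_continuous hφ.1.continuous
  exact ⟨C, fun x => hC _⟩

lemma IsTestFunction.integrable_mul {φ : (ι → ℝ) → ℝ} (hφ : IsTestFunction φ) {f : (ι → I) → ℝ}
    (hf : Integrable f) : Integrable fun x => f x * onCube φ x := by
  obtain ⟨C, hC⟩ := hφ.exists_bound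
  exact hf.mul_bdd hφ.continuous_onCube.measurable.aestronglyMeasurable (ae_of_all _ hC)

lemma measurePreserving_coe_cube :
    MeasurePreserving (fun (x : ι → I) j => (x j : ℝ)) volume
      (volume.restrict (Set.univ.pi fun _ => I)) := by
  rw [volume_pi, volume_pi, Measure.restrict_pi_pi]
  exact measurePreserving_pi _ _ fun _ => unitInterval.measurePreserving_coe

lemma measurableEmbedding_coe_cube : MeasurableEmbedding (fun (x : ι → I) j => (x j : ℝ)) := by
  refine Topology.IsClosedEmbedding.measurableEmbedding ?_
  refine Continuous.isClosedEmbedding continuous_coe_cube ?_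
  intro x y h
  ext j
  exact congrFun h j

/-- An integrable function on the cube that is orthogonal to all test functions vanishes. -/
lemma ae_eq_zero_of_integral_testFunction {d : (ι → I) → ℝ} (hd : Integrable d)
    (h : ∀ φ : (ι → ℝ) → ℝ, IsTestFunction φ → ∫ x, d x * onCube φ x = 0) : d =ᵐ[volume] 0 := by
  set c : (ι → I) → ι → ℝ := fun x j => (x j : ℝ) with hc
  -- Clamping the coordinates extends `d` to `ℝ^ι`, where the fundamental lemma of the calculus of
  -- variations on the open cube applies.
  set G : (ι → ℝ) → ℝ := fun y => d fun j => Set.projIcc 0 1 zero_le_one (y j) with hG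
  have hGc : G ∘ c = d := by
    funext x; simp [hG, hc]
  set Q : Set (ι → ℝ) := Set.univ.pi fun _ => I
  set U : Set (ι → ℝ) := Set.univ.pi fun _ => Set.Ioo (0 : ℝ) 1
  have hUQ : U ⊆ Q := Set.pi_mono fun _ _ => Set.Ioo_subset_Icc_self
  have hUo : IsOpen U := isOpen_set_pi Set.finite_univ fun _ _ => isOpen_Ioo
  have hGi : IntegrableOn G Q := by
    rw [IntegrableOn, ← measurePreserving_coe_cube.integrable_comp_emb measurableEmbedding_coe_cube]
    exact hGc.symm ▸ hd
  have key := hUo.ae_eq_zero_of_integral_contDiff_smul_eq_zero (μ := volume) (f := G)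
    (hGi.mono_set hUQ).locallyIntegrableOn fun φ h1 h2 h3 => by
      have hφ : IsTestFunction φ := ⟨h1, h2, h3⟩
      rw [← setIntegral_eq_integral_of_forall_compl_eq_zero (s := Q),
        ← measurePreserving_coe_cube.integral_comp measurableEmbedding_coe_cube]
      · rw [← h φ hφ]
        refine integral_congr_ae (ae_of_all _ fun x => ?_)
        have : G (c x) = d x := congrFun hGc x
        simp only [smul_eq_mul]
        rw [mul_comm, ← this]
      · intro y hy
        have : φ y = 0 := by
          by_contra hne
          exact hy (hUQ (h3 (subset_tsupport φ hne)))
        simp [this]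
  -- The boundary of the cube is a null set.
  have hQU : Q =ᵐ[volume] U := by
    have : Q = Set.Icc (0 : ι → ℝ) 1 := Set.pi_univ_Icc _ _
    rw [this]
    exact (Measure.univ_pi_Ioo_ae_eq_Icc (μ := fun _ : ι => (volume : Measure ℝ))
      (f := 0) (g := 1)).symm
  have key2 : ∀ᵐ y ∂(volume.restrict Q), G y = 0 := by
    rw [Measure.restrict_congr_set hQU]
    rw [ae_restrict_iff' hUo.measurableSet]
    exact key
  have := (measurePreserving_coe_cube (ι := ι)).quasiMeasurePreserving.ae key2
  filter_upwards [this] with x hx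
  have h2 : G (c x) = d x := congrFun hGc x
  rw [← h2]; exact hx

lemma IsWeakMixedDeriv.ae_eq {ι : Type} [Fintype ι] [LinearOrder ι] {u : Finset ι}
    {f g g' : (ι → I) → ℝ}
    (h : IsWeakMixedDeriv u f g) (h' : IsWeakMixedDeriv u f g') : g =ᵐ[volume] g' := by
  have := ae_eq_zero_of_integral_testFunction (h.2.1.sub h'.2.1) fun φ hφ => by
    have e := (h.2.2 φ hφ).symm.trans (h'.2.2 φ hφ)
    have e2 : ∫ x, g x * onCube φ x = ∫ x, g' x * onCube φ x :=
      mul_left_cancel₀ (pow_ne_zero _ (by norm_num)) e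
    simp only [Pi.sub_apply, sub_mul]
    rw [integral_sub (hφ.integrable_mul h.2.1) (hφ.integrable_mul h'.2.1), e2, sub_self]
  filter_upwards [this] with x hx
  simpa [sub_eq_zero] using hx

/-- By uniqueness, the arbitrary choice in `weakMixedDeriv` may be replaced by any explicitly
computed weak derivative. -/
lemma IsWeakMixedDeriv.weakMixedDeriv_ae_eq {ι : Type} [Fintype ι] [LinearOrder ι]
    {u : Finset ι} {f g : (ι → I) → ℝ}
    (h : IsWeakMixedDeriv u f g) : weakMixedDeriv u f =ᵐ[volume] g := by
  have hex : ∃ g, IsWeakMixedDeriv u f g := ⟨g, h⟩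
  rw [weakMixedDeriv, dif_pos hex]
  exact hex.choose_spec.ae_eq h

lemma isWeakMixedDeriv_sum {ι α : Type} [Fintype ι] [LinearOrder ι] {u : Finset ι}
    {A : Finset α} {f g : α → (ι → I) → ℝ} (h : ∀ a ∈ A, IsWeakMixedDeriv u (f a) (g a)) :
    IsWeakMixedDeriv u (fun x => ∑ a ∈ A, f a x) (fun x => ∑ a ∈ A, g a x) := by
  refine ⟨integrable_finsetSum _ fun a ha => (h a ha).1,
    integrable_finsetSum _ fun a ha => (h a ha).2.1, fun φ hφ => ?_⟩
  have e := integral_finsetSum A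
    fun a ha => (hφ.foldr (u.sort (· ≤ ·))).integrable_mul (h a ha).1
  simp only [Finset.sum_mul]
  rw [integral_finsetSum _ fun a ha => hφ.integrable_mul (h a ha).2.1, Finset.mul_sum]
  refine e.trans ?_
  exact Finset.sum_congr rfl fun a ha => (h a ha).2.2 φ hφ

end TestFunctions

/-- The indicator `1_{[0,x)}(t)`. -/
noncomputable def stepKernel (x t : I) : ℝ :=
  (Set.Ico (0 : I) x).indicator (fun _ => (1 : ℝ)) t

lemma stepKernel_eq (x t : I) : stepKernel x t = if t < x then 1 else 0 := by
  simp [stepKernel, Set.indicator_apply]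

lemma measurable_stepKernel : Measurable fun z : I × I => stepKernel z.1 z.2 := by
  simp only [stepKernel_eq]
  exact Measurable.ite (measurableSet_lt measurable_snd measurable_fst) measurable_const
    measurable_const

lemma stepKernel_nonneg (x t : I) : 0 ≤ stepKernel x t := by
  rw [stepKernel_eq]; split_ifs <;> norm_num

lemma stepKernel_le_one (x t : I) : stepKernel x t ≤ 1 := by
  rw [stepKernel_eq]; split_ifs <;> norm_num

/-! ### Integration by parts in one coordinate -/

section OneVariable

variable {ι : Type} [Fintype ι] [DecidableEq ι]

omit [Fintype ι] in
lemma coe_update_cube (x : ι → I) (j : ι) (τ : I) :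
    (fun k => (Function.update x j τ k : ℝ)) =
      Function.update (fun k => (x k : ℝ)) j (τ : ℝ) := by
  funext k
  by_cases h : k = j
  · subst h; simp
  · simp [h]

lemma IsTestFunction.hasDerivAt_update {φ : (ι → ℝ) → ℝ} (hφ : IsTestFunction φ)
    (y : ι → ℝ) (j : ι) (r : ℝ) :
    HasDerivAt (fun r => φ (Function.update y j r))
      (WeightedSpaces.partialDeriv j φ (Function.update y j r)) r := by
  have h1 : HasFDerivAt φ (fderiv ℝ φ (Function.update y j r)) (Function.update y j r) :=
    ((hφ.1.differentiable (by simp)) _).hasFDerivAt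
  exact h1.comp_hasDerivAt r (_root_.hasDerivAt_update y j r)

lemma IsTestFunction.integral_partialDeriv {φ : (ι → ℝ) → ℝ} (hφ : IsTestFunction φ)
    (y : ι → ℝ) (j : ι) {c : ℝ} (hc : c ≤ 1) :
    ∫ r in Set.Ioc c 1, WeightedSpaces.partialDeriv j φ (Function.update y j r) =
      -φ (Function.update y j c) := by
  rw [← intervalIntegral.integral_of_le hc,
    intervalIntegral.integral_eq_sub_of_hasDerivAt (f := fun r => φ (Function.update y j r))
      fun r _ => hφ.hasDerivAt_update y j r]
  · rw [hφ.eq_zero (y := Function.update y j 1) (j := j) (by simp)]; simp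
  · refine Continuous.intervalIntegrable ?_ _ _
    exact (hφ.partialDeriv j).1.continuous.comp (continuous_const.update j continuous_id)

/-- In its first argument the step kernel is the indicator of `(c,1]`, so the fundamental theorem of
calculus applies; the endpoint `1` contributes nothing because test functions vanish there. -/
lemma IsTestFunction.integral_stepKernel_mul_partialDeriv {φ : (ι → ℝ) → ℝ}
    (hφ : IsTestFunction φ) (x : ι → I) (j : ι) (c : I) :
    ∫ τ : I, stepKernel τ c * onCube (WeightedSpaces.partialDeriv j φ) (Function.update x j τ) =
      -onCube φ (Function.update x j c) := by
  simp only [onCube, coe_update_cube]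
  rw [← hφ.integral_partialDeriv _ j c.2.2]
  have h := integral_subtype (measurableSet_Icc : MeasurableSet I)
    ((Set.Ioi (c : ℝ)).indicator fun r =>
      WeightedSpaces.partialDeriv j φ (Function.update (fun k => (x k : ℝ)) j r))
  rw [setIntegral_indicator measurableSet_Ioi] at h
  have hs : I ∩ Set.Ioi (c : ℝ) = Set.Ioc (c : ℝ) 1 := by
    ext r
    simp only [Set.mem_inter_iff, Set.mem_Icc, Set.mem_Ioi, Set.mem_Ioc]
    exact ⟨fun h => ⟨h.2, h.1.2⟩, fun h => ⟨⟨c.2.1.trans h.1.le, h.2⟩, h.1⟩⟩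
  rw [hs] at h
  rw [← h]
  refine integral_congr_ae (ae_of_all _ fun τ => ?_)
  simp only [stepKernel_eq, Set.indicator_apply, Set.mem_Ioi, Subtype.coe_lt_coe]
  split_ifs <;> simp

lemma IsTestFunction.integral_partialDeriv_eq_zero {φ : (ι → ℝ) → ℝ} (hφ : IsTestFunction φ)
    (x : ι → I) (j : ι) :
    ∫ τ : I, onCube (WeightedSpaces.partialDeriv j φ) (Function.update x j τ) = 0 := by
  simp only [onCube, coe_update_cube]
  rw [integral_subtype (measurableSet_Icc : MeasurableSet I) (fun r =>
      WeightedSpaces.partialDeriv j φ (Function.update (fun k => (x k : ℝ)) j r)),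
    integral_Icc_eq_integral_Ioc, hφ.integral_partialDeriv _ j zero_le_one, neg_eq_zero]
  exact hφ.eq_zero (j := j) (by simp)

/-- Fubini's theorem in one coordinate. -/
lemma integral_eq_integral_update {F : (ι → I) → ℝ} (hF : Integrable F) (j : ι) :
    ∫ x, F x = ∫ x, ∫ τ : I, F (Function.update x j τ) := by
  have h := measurePreserving_update (ι := ι) j
  have h2 : ∫ x, F x = ∫ z : (ι → I) × I, F (Function.update z.1 j z.2) := by
    rw [← integral_map h.measurable.aemeasurable (by rw [h.map_eq]; exact hF.1), h.map_eq]
  rw [h2]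
  exact integral_prod (fun z : (ι → I) × I => F (Function.update z.1 j z.2))
    (h.integrable_comp_of_integrable hF)

end OneVariable

end WeightedSpaces

namespace WeightedSpaces

/-! ### Differentiating integrals against step kernels -/

section PartialInt

variable {ι : Type} [Fintype ι] [DecidableEq ι]

/-- `∫ H([x_u; t_{uᶜ}]) ∏_{j ∈ v \ u} 1_{[0,x_j)}(t_j) dt`, the mixed derivative with respect to
`x_u` of `∫ H(t) ∏_{j ∈ v} 1_{[0,x_j)}(t_j) dt` when `u ⊆ v`. -/
noncomputable def partialInt (u v : Finset ι) (H : (ι → I) → ℝ) (x : ι → I) : ℝ :=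
  ∫ t : ι → I, H (u.piecewise x t) * ∏ j ∈ v \ u, stepKernel (x j) (t j)

omit [Fintype ι] [DecidableEq ι] in
lemma measurable_prod_stepKernel (w : Finset ι) :
    Measurable fun z : (ι → I) × (ι → I) => ∏ j ∈ w, stepKernel (z.1 j) (z.2 j) :=
  Finset.measurable_prod _ fun j _ => measurable_stepKernel.comp
    (g := fun z : I × I => stepKernel z.1 z.2)
    (f := fun z : (ι → I) × (ι → I) => (z.1 j, z.2 j))
    (((measurable_pi_apply j).comp measurable_fst).prodMk
      ((measurable_pi_apply j).comp measurable_snd))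

omit [Fintype ι] [DecidableEq ι] in
lemma norm_prod_stepKernel_le (w : Finset ι) (x t : ι → I) :
    ‖∏ j ∈ w, stepKernel (x j) (t j)‖ ≤ 1 := by
  rw [Real.norm_of_nonneg (Finset.prod_nonneg fun j _ => stepKernel_nonneg _ _)]
  exact Finset.prod_le_one (fun j _ => stepKernel_nonneg _ _) fun j _ => stepKernel_le_one _ _

lemma aestronglyMeasurable_kernel {H : (ι → I) → ℝ} (hH : AEStronglyMeasurable H)
    (u w : Finset ι) :
    AEStronglyMeasurable (fun z : (ι → I) × (ι → I) =>
      H (u.piecewise z.1 z.2) * ∏ j ∈ w, stepKernel (z.1 j) (z.2 j)) :=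
  (hH.comp_measurePreserving (measurePreserving_piecewise u)).mul
    (measurable_prod_stepKernel w).aestronglyMeasurable

lemma integrable_kernel {H : (ι → I) → ℝ} (hH : Integrable H) (u w : Finset ι) :
    Integrable (fun z : (ι → I) × (ι → I) =>
      H (u.piecewise z.1 z.2) * ∏ j ∈ w, stepKernel (z.1 j) (z.2 j)) :=
  ((measurePreserving_piecewise u).integrable_comp_of_integrable hH).mul_bdd
    (measurable_prod_stepKernel w).aestronglyMeasurable
    (ae_of_all _ fun z => norm_prod_stepKernel_le w z.1 z.2)

lemma integrable_partialInt {H : (ι → I) → ℝ} (hH : Integrable H) (u v : Finset ι) :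
    Integrable (partialInt u v H) :=
  (integrable_kernel hH u (v \ u)).integral_prod_left

lemma eLpNorm_partialInt_le {H : (ι → I) → ℝ} (hH : AEStronglyMeasurable H) (u v : Finset ι)
    {p : ℝ} (hp : 1 ≤ p) :
    eLpNorm (partialInt u v H) (ENNReal.ofReal p) volume ≤
      eLpNorm H (ENNReal.ofReal p) volume := by
  refine (eLpNorm_integral_prod_right_le (aestronglyMeasurable_kernel hH u (v \ u)) hp).trans ?_
  rw [← eLpNorm_comp_measurePreserving hH (measurePreserving_piecewise u)]
  refine eLpNorm_mono fun z => ?_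
  rw [norm_mul]
  exact mul_le_of_le_one_right (norm_nonneg _) (norm_prod_stepKernel_le _ _ _)

/-- The weak derivative of `x_j ↦ stepKernel (x_j) c` is the Dirac mass at `c`. -/
lemma integral_mul_stepKernel_mul_partialDeriv {A : (ι → I) → ℝ} (hA : Integrable A) {j : ι}
    (hAj : ∀ x τ, A (Function.update x j τ) = A x) (c : I) {φ : (ι → ℝ) → ℝ}
    (hφ : IsTestFunction φ) :
    ∫ x, A x * stepKernel (x j) c * onCube (partialDeriv j φ) x =
      -∫ x, A x * onCube φ (Function.update x j c) := by
  have hi : Integrable fun x => A x * stepKernel (x j) c := by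
    refine hA.mul_bdd (c := 1) ?_ (ae_of_all _ fun x => ?_)
    · exact (measurable_stepKernel.comp (f := fun x : ι → I => (x j, c))
        ((measurable_pi_apply j).prodMk measurable_const)).aestronglyMeasurable
    · rw [Real.norm_of_nonneg (stepKernel_nonneg _ _)]
      exact stepKernel_le_one _ _
  rw [integral_eq_integral_update ((hφ.partialDeriv j).integrable_mul hi) j, ← integral_neg]
  refine integral_congr_ae (ae_of_all _ fun x => ?_)
  simp only [hAj, Function.update_self, mul_assoc]
  rw [integral_const_mul, hφ.integral_stepKernel_mul_partialDeriv]
  ring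

lemma integral_mul_partialDeriv_eq_zero {A : (ι → I) → ℝ} (hA : Integrable A) {j : ι}
    (hAj : ∀ x τ, A (Function.update x j τ) = A x) {φ : (ι → ℝ) → ℝ} (hφ : IsTestFunction φ) :
    ∫ x, A x * onCube (partialDeriv j φ) x = 0 := by
  rw [integral_eq_integral_update ((hφ.partialDeriv j).integrable_mul hA) j]
  simp only [hAj]
  simp only [integral_const_mul, hφ.integral_partialDeriv_eq_zero, mul_zero, integral_zero]

omit [Fintype ι] [DecidableEq ι] in
lemma prod_stepKernel_congr {w : Finset ι} {j : ι} (hj : j ∉ w) {x x' t t' : ι → I}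
    (hx : ∀ k ≠ j, x k = x' k) (ht : ∀ k ≠ j, t k = t' k) :
    ∏ k ∈ w, stepKernel (x k) (t k) = ∏ k ∈ w, stepKernel (x' k) (t' k) := by
  refine Finset.prod_congr rfl fun k hk => ?_
  have : k ≠ j := fun h => hj (h ▸ hk)
  rw [hx k this, ht k this]

/-- The factor `stepKernel (x_j) (t_j)` differentiates to a Dirac mass at `t_j`, which puts `t_j` in
place of `x_j` in the test function. Renaming `x_j ↔ t_j` restores the test function and makes `H`
read its coordinate `j` from `x` instead of `t`. -/
lemma integral_partialInt_mul_partialDeriv {H : (ι → I) → ℝ} (hH : Integrable H)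
    {u v : Finset ι} {j : ι} (hju : j ∉ u) (hjv : j ∈ v) {φ : (ι → ℝ) → ℝ}
    (hφ : IsTestFunction φ) :
    ∫ x, partialInt u v H x * onCube (partialDeriv j φ) x =
      -∫ x, partialInt (insert j u) v H x * onCube φ x := by
  set w := v \ insert j u with hw
  have hjw : j ∉ w := by simp [hw]
  have hvu : v \ u = insert j w := by
    ext k; by_cases hk : k = j <;> simp [hw, hk, hju, hjv]
  -- The integrand without its `j`-th kernel: it is independent of `x_j`, because `j` lies neither
  -- in `u` nor in `w`.
  set B : (ι → I) × (ι → I) → ℝ := fun z =>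
    H (u.piecewise z.1 z.2) * ∏ k ∈ w, stepKernel (z.1 k) (z.2 k) with hB
  have hBi : Integrable B := integrable_kernel hH u w
  have hBj : ∀ t x τ, B (Function.update x j τ, t) = B (x, t) := by
    intro t x τ
    simp only [hB]
    congr 1
    · congr 1
      ext k
      by_cases hk : k = j
      · subst hk; simp [hju]
      · simp [Finset.piecewise, hk]
    · exact prod_stepKernel_congr hjw (fun k hk => by simp [hk]) fun k _ => rfl
  have hsplit : ∀ x t, H (u.piecewise x t) * ∏ k ∈ v \ u, stepKernel (x k) (t k) =
      B (x, t) * stepKernel (x j) (t j) := by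
    intro x t
    rw [hvu, Finset.prod_insert hjw]
    simp only [hB]; ring
  obtain ⟨C, hC⟩ := (hφ.partialDeriv j).exists_bound
  obtain ⟨C', hC'⟩ := hφ.exists_bound
  have hFi : Integrable (fun z : (ι → I) × (ι → I) =>
      B (z.1, z.2) * stepKernel (z.1 j) (z.2 j) * onCube (partialDeriv j φ) z.1) := by
    refine Integrable.mul_bdd (c := C) ?_ ?_ (ae_of_all _ fun z => hC _)
    · refine (integrable_kernel hH u (v \ u)).congr (ae_of_all _ fun z => ?_)
      exact hsplit z.1 z.2
    · exact ((hφ.partialDeriv j).continuous_onCube.measurable.comp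
        measurable_fst).aestronglyMeasurable
  have hL : ∫ x, partialInt u v H x * onCube (partialDeriv j φ) x =
      ∫ x, ∫ t, B (x, t) * stepKernel (x j) (t j) * onCube (partialDeriv j φ) x := by
    refine integral_congr_ae (ae_of_all _ fun x => ?_)
    simp only [partialInt, hsplit]
    rw [← integral_mul_const]
  set G : (ι → I) × (ι → I) → ℝ := fun z =>
    H ((insert j u).piecewise z.1 z.2) * (∏ k ∈ w, stepKernel (z.1 k) (z.2 k)) * onCube φ z.1
    with hG
  have hGi : Integrable G :=
    (integrable_kernel hH (insert j u) w).mul_bdd (hφ.continuous_onCube.measurable.comp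
        measurable_fst).aestronglyMeasurable (ae_of_all _ fun z => hC' _)
  set sw : (ι → I) × (ι → I) → (ι → I) × (ι → I) := fun z =>
    (Function.update z.1 j (z.2 j), Function.update z.2 j (z.1 j)) with hsw
  have hmp : MeasurePreserving sw := measurePreserving_swap_coord j
  have hswap : ∀ z, G (sw z) = B z * onCube φ (Function.update z.1 j (z.2 j)) := by
    intro z
    simp only [hG, hsw, hB]
    congr 2
    · congr 1
      ext k
      by_cases hk : k = j
      · subst hk; simp [hju]
      · simp [Finset.piecewise, hk]
    · exact prod_stepKernel_congr hjw (fun k hk => by simp [hk]) fun k hk => by simp [hk]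
  rw [hL, integral_integral_swap hFi]
  have hR : ∫ x, partialInt (insert j u) v H x * onCube φ x = ∫ z, G z := by
    refine Eq.trans ?_ (integral_prod G hGi).symm
    refine integral_congr_ae (ae_of_all _ fun x => ?_)
    simp only [partialInt, hG]
    rw [← integral_mul_const]
  have hswG : ∫ z, G z = ∫ z, G (sw z) := by
    rw [← integral_map hmp.measurable.aemeasurable (by rw [hmp.map_eq]; exact hGi.1), hmp.map_eq]
  have hGsw : Integrable (fun z => G (sw z)) := hmp.integrable_comp_of_integrable hGi
  rw [hR, hswG, ← integral_neg]
  -- With `t` fixed, the claim reduces to the one-coordinate formula in `x`.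
  refine Eq.trans ?_ (integral_prod_symm _ hGsw.neg).symm
  refine integral_congr_ae ?_
  filter_upwards [hBi.prod_left_ae] with t ht
  simp only [Pi.neg_apply, hswap, integral_neg]
  exact integral_mul_stepKernel_mul_partialDeriv ht (hBj t) (t j) hφ

lemma partialInt_update {H : (ι → I) → ℝ} {u v : Finset ι} {j : ι} (hjv : j ∉ v)
    (hHj : ∀ x τ, H (Function.update x j τ) = H x) (x : ι → I) (τ : I) :
    partialInt u v H (Function.update x j τ) = partialInt u v H x := by
  refine integral_congr_ae (ae_of_all _ fun t => ?_)
  simp only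
  congr 1
  -- `H` ignores coordinate `j`, so both arguments may be reset to `x j` there, after which they
  -- agree.
  · rw [← hHj (u.piecewise (Function.update x j τ) t) (x j), ← hHj (u.piecewise x t) (x j)]
    congr 1
    ext k
    by_cases hk : k = j
    · subst hk; simp
    · simp [Finset.piecewise, hk]
  · exact prod_stepKernel_congr (j := j) (by simp [hjv]) (fun k hk => by simp [hk]) fun k _ => rfl

/-- Each differentiation contributes a sign and moves one index into `u`; the induction therefore
needs `u` arbitrary. -/
lemma integral_partialInt_mul_foldr {H : (ι → I) → ℝ} (hH : Integrable H) {v : Finset ι}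
    {φ : (ι → ℝ) → ℝ} (hφ : IsTestFunction φ) (l : List ι) (hl : l.Nodup) (u : Finset ι)
    (hlu : ∀ j ∈ l, j ∉ u) (hlv : ∀ j ∈ l, j ∈ v) :
    ∫ x, partialInt u v H x * onCube (l.foldr partialDeriv φ) x =
      (-1) ^ l.length * ∫ x, partialInt (u ∪ l.toFinset) v H x * onCube φ x := by
  induction l generalizing u with
  | nil => simp
  | cons j l ih =>
    rw [List.foldr_cons, integral_partialInt_mul_partialDeriv hH (hlu j (by simp))
      (hlv j (by simp)) (hφ.foldr l), ih (List.nodup_cons.1 hl).2]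
    · rw [List.length_cons, pow_succ, List.toFinset_cons, Finset.insert_union,
        Finset.union_insert]
      ring
    · intro k hk
      rw [Finset.mem_insert, not_or]
      exact ⟨fun h => (List.nodup_cons.1 hl).1 (h ▸ hk), hlu k (by simp [hk])⟩
    · exact fun k hk => hlv k (by simp [hk])

/-- Indices in `v` are integrated by parts as before; at the first index outside `v` the function is
constant in that coordinate and the integral vanishes. -/
lemma integral_partialInt_mul_foldr_eq_zero {H : (ι → I) → ℝ} (hH : Integrable H)
    {v : Finset ι} (hHv : ∀ j ∉ v, ∀ x τ, H (Function.update x j τ) = H x)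
    {φ : (ι → ℝ) → ℝ} (hφ : IsTestFunction φ) (l : List ι) (hl : l.Nodup) (u : Finset ι)
    (hlu : ∀ j ∈ l, j ∉ u) (hlv : ∃ j ∈ l, j ∉ v) :
    ∫ x, partialInt u v H x * onCube (l.foldr partialDeriv φ) x = 0 := by
  induction l generalizing u with
  | nil => simp at hlv
  | cons j l ih =>
    rw [List.foldr_cons]
    by_cases hjv : j ∈ v
    · rw [integral_partialInt_mul_partialDeriv hH (hlu j (by simp)) hjv (hφ.foldr l),
        ih (List.nodup_cons.1 hl).2, neg_zero]
      · intro k hk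
        rw [Finset.mem_insert, not_or]
        exact ⟨fun h => (List.nodup_cons.1 hl).1 (h ▸ hk), hlu k (by simp [hk])⟩
      · obtain ⟨k, hk, hkv⟩ := hlv
        refine ⟨k, ?_, hkv⟩
        rcases List.mem_cons.1 hk with rfl | h
        · exact absurd hjv hkv
        · exact h
    · exact integral_mul_partialDeriv_eq_zero (integrable_partialInt hH u v)
        (partialInt_update hjv (hHv j hjv)) (hφ.foldr l)

end PartialInt

section WeakDerivative

variable {ι : Type} [Fintype ι] [LinearOrder ι]

lemma isWeakMixedDeriv_partialInt {H : (ι → I) → ℝ} (hH : Integrable H) {u v : Finset ι}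
    (huv : u ⊆ v) : IsWeakMixedDeriv u (partialInt ∅ v H) (partialInt u v H) := by
  refine ⟨integrable_partialInt hH _ _, integrable_partialInt hH _ _, fun φ hφ => ?_⟩
  have := integral_partialInt_mul_foldr hH (v := v) hφ (u.sort (· ≤ ·)) (u.sort_nodup _) ∅
    (by simp) (fun j hj => huv (by simpa using hj))
  simp only [Finset.length_sort, Finset.sort_toFinset, Finset.empty_union] at this
  exact this

lemma isWeakMixedDeriv_partialInt_zero {H : (ι → I) → ℝ} (hH : Integrable H) {u v : Finset ι}
    (hHv : ∀ j ∉ v, ∀ x τ, H (Function.update x j τ) = H x) (huv : ¬ u ⊆ v) :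
    IsWeakMixedDeriv u (partialInt ∅ v H) 0 := by
  refine ⟨integrable_partialInt hH _ _, integrable_zero _ _ _, fun φ hφ => ?_⟩
  obtain ⟨j, hju, hjv⟩ := Finset.not_subset.1 huv
  have := integral_partialInt_mul_foldr_eq_zero hH hHv hφ (u.sort (· ≤ ·)) (u.sort_nodup _) ∅
    (by simp) ⟨j, by simpa using hju, hjv⟩
  simp only [Pi.zero_apply, zero_mul, integral_zero, mul_zero]
  exact this

end WeakDerivative

end WeightedSpaces

/-! ### Weak derivatives of anchored functions and bounds for the ANOVA terms -/

namespace WeightedSpaces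

/-- Integrating over extra coordinates of total mass one changes nothing. The map `e` is later the
inclusion of `v` into `Fin s`, or into a larger coordinate set `u`. -/
lemma integral_mul_prod_stepKernel_eq_partialInt {ι κ : Type} [Fintype ι] [DecidableEq ι]
    [Fintype κ] {e : κ → ι} (he : Function.Injective e) {h : (κ → I) → ℝ}
    (hh : AEStronglyMeasurable h) (x : ι → I) :
    ∫ t : κ → I, h t * ∏ k, stepKernel (x (e k)) (t k) =
      partialInt ∅ (Finset.univ.map ⟨e, he⟩) (fun y => h fun k => y (e k)) x := by
  have hmp := measurePreserving_comp_injective he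
  simp only [partialInt, Finset.piecewise_empty, Finset.sdiff_empty, Finset.prod_map,
    Function.Embedding.coeFn_mk]
  have hm : AEStronglyMeasurable (fun t : κ → I => h t * ∏ k, stepKernel (x (e k)) (t k)) := by
    refine hh.mul (Measurable.aestronglyMeasurable ?_)
    exact Finset.measurable_prod _ fun k _ => measurable_stepKernel.comp
      (f := fun t : κ → I => (x (e k), t k)) (measurable_const.prodMk (measurable_pi_apply k))
  rw [← integral_map (φ := fun y : ι → I => fun k => y (e k))
    (f := fun t : κ → I => h t * ∏ k, stepKernel (x (e k)) (t k))
    hmp.measurable.aemeasurable (by rw [hmp.map_eq]; exact hm), hmp.map_eq]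

lemma partialInt_univ {ι : Type} [Fintype ι] [DecidableEq ι] (H : (ι → I) → ℝ) :
    partialInt Finset.univ Finset.univ H = H := by
  funext x
  simp [partialInt, Finset.piecewise_univ]

variable {s : ℕ}

/-- A function of the variables in `v`, as a function of all variables. -/
abbrev extendVars (v : Finset (Fin s)) (h : (v → I) → ℝ) : (Fin s → I) → ℝ :=
  fun x => h fun j => x j

lemma measurePreserving_restrictVars (v : Finset (Fin s)) :
    MeasurePreserving (fun (x : Fin s → I) (j : v) => x j) :=
  measurePreserving_comp_injective Subtype.val_injective

lemma anchoredOp_eq_partialInt (v : Finset (Fin s)) {h : (v → I) → ℝ}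
    (hh : AEStronglyMeasurable h) : anchoredOp v h = partialInt ∅ v (extendVars v h) := by
  funext x
  have := integral_mul_prod_stepKernel_eq_partialInt (e := ((↑) : v → Fin s))
    Subtype.val_injective hh x
  have hv : Finset.univ.map ⟨((↑) : v → Fin s), Subtype.val_injective⟩ = v := by
    ext j; simp
  rw [hv] at this
  exact this

lemma integrable_extendVars {v : Finset (Fin s)} {h : (v → I) → ℝ} (hh : Integrable h) :
    Integrable (extendVars v h) :=
  (measurePreserving_restrictVars v).integrable_comp_of_integrable hh

lemma extendVars_update (v : Finset (Fin s)) (h : (v → I) → ℝ) {j : Fin s} (hj : j ∉ v)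
    (x : Fin s → I) (τ : I) : extendVars v h (Function.update x j τ) = extendVars v h x := by
  simp only [extendVars]
  congr 1
  funext k
  rw [Function.update_of_ne]
  exact fun hk => hj (hk ▸ k.2)

lemma isWeakMixedDeriv_anchoredOp {u v : Finset (Fin s)} {h : (v → I) → ℝ} (hh : Integrable h) :
    IsWeakMixedDeriv u (anchoredOp v h)
      (if u ⊆ v then partialInt u v (extendVars v h) else 0) := by
  rw [anchoredOp_eq_partialInt v hh.1]
  split_ifs with huv
  · exact isWeakMixedDeriv_partialInt (integrable_extendVars hh) huv
  · exact isWeakMixedDeriv_partialInt_zero (integrable_extendVars hh)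
      (fun j hj => extendVars_update v h hj) huv

lemma isWeakMixedDeriv_zero {ι : Type} [Fintype ι] [LinearOrder ι] (u : Finset ι) :
    IsWeakMixedDeriv u (fun _ : ι → I => (0 : ℝ)) 0 :=
  ⟨integrable_zero _ _ _, integrable_zero _ _ _, fun φ _ => by simp⟩

lemma isWeakMixedDeriv_anchoredOp_glue_self {u : Finset (Fin s)} {h : (u → I) → ℝ}
    (hh : Integrable h) :
    IsWeakMixedDeriv Finset.univ (fun x : u → I => anchoredOp u h (glue u x fun _ => 0)) h := by
  have h1 := isWeakMixedDeriv_partialInt hh (Finset.Subset.refl (Finset.univ : Finset u))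
  have e1 : (fun x : u → I => anchoredOp u h (glue u x fun _ => 0)) =
      partialInt ∅ Finset.univ h := by
    funext x
    simp [anchoredOp, partialInt, glue, stepKernel]
  rw [partialInt_univ] at h1
  rw [e1]
  exact h1

/-- If `v ⊊ u`, the function is constant in some variable of `u`. If `v ⊄ u`, some coordinate of `v`
is anchored at `0`, where the kernel `1_{[0,0)}` vanishes. -/
lemma isWeakMixedDeriv_anchoredOp_glue_of_ne {u v : Finset (Fin s)} (hvu : v ≠ u)
    {h : (v → I) → ℝ} (hh : Integrable h) :
    IsWeakMixedDeriv Finset.univ (fun x : u → I => anchoredOp v h (glue u x fun _ => 0)) 0 := by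
  by_cases hsub : v ⊆ u
  · have he : Function.Injective fun k : v => (⟨k, hsub k.2⟩ : u) := fun a b hab =>
      Subtype.ext (congrArg (fun z : u => (z : Fin s)) hab)
    have e1 : (fun x : u → I => anchoredOp v h (glue u x fun _ => 0)) =
        partialInt ∅ (Finset.univ.map ⟨_, he⟩) (fun y => h fun k => y ⟨k, hsub k.2⟩) := by
      funext x
      rw [← integral_mul_prod_stepKernel_eq_partialInt he hh.1]
      refine integral_congr_ae (ae_of_all _ fun t => ?_)
      simp only
      congr 1
      refine Finset.prod_congr rfl fun k _ => ?_
      rw [glue, dif_pos (hsub k.2)]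
      rfl
    rw [e1]
    refine isWeakMixedDeriv_partialInt_zero
      ((measurePreserving_comp_injective he).integrable_comp_of_integrable hh) ?_ ?_
    · intro j hj x τ
      refine congrArg h (funext fun k => ?_)
      refine Function.update_of_ne ?_ _ _
      exact fun hk => hj (Finset.mem_map.2 ⟨k, Finset.mem_univ _, hk⟩)
    · obtain ⟨j, hju, hjv⟩ := Finset.not_subset.1 fun h => hvu (hsub.antisymm h)
      intro hcon
      have := hcon (Finset.mem_univ ⟨j, hju⟩)
      simp only [Finset.mem_map, Finset.mem_univ, true_and, Function.Embedding.coeFn_mk,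
        Subtype.mk.injEq] at this
      obtain ⟨a, ha⟩ := this
      exact hjv (ha ▸ a.2)
  · obtain ⟨j, hjv, hju⟩ := Finset.not_subset.1 hsub
    have e1 : (fun x : u → I => anchoredOp v h (glue u x fun _ => 0)) = fun _ => 0 := by
      funext x
      refine integral_eq_zero_of_ae (ae_of_all _ fun t => ?_)
      simp only [Pi.zero_apply]
      rw [Finset.prod_eq_zero (Finset.mem_univ (⟨j, hjv⟩ : v)), mul_zero]
      simp [glue, hju]
    rw [e1]
    exact isWeakMixedDeriv_zero _

/-- This recovers the densities from `f`, so that the anchored norm can be expressed through the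
`‖h_u‖_p`. -/
lemma anchoredDeriv_ae_eq {U : Finset (Finset (Fin s))} {f : (Fin s → I) → ℝ}
    {h : (u : Finset (Fin s)) → (u → I) → ℝ} (hh : ∀ u, Integrable (h u))
    (hf : ∀ x, f x = ∑ u ∈ U, anchoredOp u (h u) x) {u : Finset (Fin s)} (hu : u ∈ U) :
    anchoredDeriv f u =ᵐ[volume] h u := by
  have h1 : IsWeakMixedDeriv (Finset.univ : Finset u) (fun x : u → I => f (glue u x fun _ => 0))
      (fun x => ∑ v ∈ U, (if v = u then h u else 0) x) := by
    simp only [hf]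
    refine isWeakMixedDeriv_sum fun v _ => ?_
    by_cases hv : v = u
    · subst hv
      simpa using isWeakMixedDeriv_anchoredOp_glue_self (hh v)
    · simpa [hv] using isWeakMixedDeriv_anchoredOp_glue_of_ne hv (hh v)
  have h2 : (fun x => ∑ v ∈ U, (if v = u then h u else 0) x) = h u := by
    funext x
    rw [Finset.sum_eq_single u (fun v _ hv => by simp [hv]) fun h => absurd hu h]
    simp
  rw [h2] at h1
  exact h1.weakMixedDeriv_ae_eq

lemma isWeakMixedDeriv_anchored {U : Finset (Finset (Fin s))} {f : (Fin s → I) → ℝ}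
    {h : (u : Finset (Fin s)) → (u → I) → ℝ} (hh : ∀ u, Integrable (h u))
    (hf : ∀ x, f x = ∑ u ∈ U, anchoredOp u (h u) x) (u : Finset (Fin s)) :
    IsWeakMixedDeriv u f
      (∑ v ∈ U with u ⊆ v, partialInt u v (extendVars v (h v))) := by
  have h1 : IsWeakMixedDeriv u (fun x => ∑ v ∈ U, anchoredOp v (h v) x)
      (fun x => ∑ v ∈ U, (if u ⊆ v then partialInt u v (extendVars v (h v)) else 0) x) :=
    isWeakMixedDeriv_sum fun v _ => isWeakMixedDeriv_anchoredOp (hh v)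
  rw [← funext hf] at h1
  convert h1 using 1
  rw [Finset.sum_filter]
  funext x
  rw [Finset.sum_apply]

lemma eLpNorm_anovaDeriv_le_weakMixedDeriv {f : (Fin s → I) → ℝ} {u : Finset (Fin s)}
    (hW : AEStronglyMeasurable (weakMixedDeriv u f)) {p : ℝ} (hp : 1 ≤ p) :
    eLpNorm (anovaDeriv f u) (ENNReal.ofReal p) volume ≤
      eLpNorm (weakMixedDeriv u f) (ENNReal.ofReal p) volume := by
  have hg := measurePreserving_glue u
  rw [← eLpNorm_comp_measurePreserving hW hg]
  exact eLpNorm_integral_prod_right_le (hW.comp_measurePreserving hg) hp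

/-- The terms of the ANOVA norm are controlled by those of the anchored norm. -/
lemma eLpNorm_anovaDeriv_le {U : Finset (Finset (Fin s))} {f : (Fin s → I) → ℝ}
    {h : (u : Finset (Fin s)) → (u → I) → ℝ} (hh : ∀ u, Integrable (h u))
    (hf : ∀ x, f x = ∑ u ∈ U, anchoredOp u (h u) x) (u : Finset (Fin s)) {p : ℝ} (hp : 1 ≤ p) :
    eLpNorm (anovaDeriv f u) (ENNReal.ofReal p) volume ≤
      ∑ v ∈ U with u ⊆ v, eLpNorm (h v) (ENNReal.ofReal p) volume := by
  have hd := isWeakMixedDeriv_anchored hh hf u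
  have hW := hd.weakMixedDeriv_ae_eq
  refine (eLpNorm_anovaDeriv_le_weakMixedDeriv (hd.2.1.1.congr hW.symm) hp).trans ?_
  rw [eLpNorm_congr_ae hW]
  refine (eLpNorm_sum_le (fun v _ => (integrable_partialInt
    (integrable_extendVars (hh v)) u v).1) (by simpa using hp)).trans ?_
  refine Finset.sum_le_sum fun v _ => ?_
  refine (eLpNorm_partialInt_le (integrable_extendVars (hh v)).1 u v hp).trans_eq ?_
  exact eLpNorm_comp_measurePreserving (hh v).1 (measurePreserving_restrictVars v)

/-- The term `u = ∅` integrates `f` over all variables; it is the only ANOVA term the lower bound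
needs. -/
lemma enorm_integral_le_eLpNorm_anovaDeriv_empty {f : (Fin s → I) → ℝ} (hf : Integrable f)
    {p : ℝ} (hp : 1 ≤ p) :
    ‖∫ x, f x‖ₑ ≤ eLpNorm (anovaDeriv f ∅) (ENNReal.ofReal p) volume := by
  have hd : IsWeakMixedDeriv ∅ f f := ⟨hf, hf, fun φ _ => by simp [mixedPartial]⟩
  have hW := hd.weakMixedDeriv_ae_eq
  have hWi : Integrable (weakMixedDeriv ∅ f) := hf.congr hW.symm
  have hg := measurePreserving_glue (∅ : Finset (Fin s))
  have hWg := hg.integrable_comp_of_integrable hWi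
  have hA : AEStronglyMeasurable (anovaDeriv f ∅) := hWg.1.integral_prod_right'
  have e : ∫ x, f x = ∫ x, anovaDeriv f ∅ x := by
    rw [← integral_congr_ae hW]
    have e1 : ∫ x, weakMixedDeriv ∅ f x = ∫ z, (weakMixedDeriv ∅ f ∘ fun z :
        ((∅ : Finset (Fin s)) → I) × ({j // j ∉ (∅ : Finset (Fin s))} → I) =>
          glue ∅ z.1 z.2) z := by
      rw [← hg.map_eq, integral_map hg.measurable.aemeasurable (by rw [hg.map_eq]; exact hWi.1)]
      rfl
    rw [e1]
    exact integral_prod _ hWg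
  rw [e]
  refine (enorm_integral_le_lintegral_enorm _).trans ?_
  rw [← eLpNorm_one_eq_lintegral_enorm]
  exact eLpNorm_le_eLpNorm_of_exponent_le (by simpa using hp) hA

/-! ### Inclusion of the anchored space in the ANOVA space -/

section Inclusion

variable {u v : Finset (Fin s)}

/-- The density of the component `u` of the ANOVA decomposition of `anchoredOp v h`. -/
noncomputable def anovaDensity (u v : Finset (Fin s)) (h : (v → I) → ℝ) (y : u → I) : ℝ :=
  ∫ t : {j // j ∉ u} → I, extendVars v h (glue u y t) *
    ∏ j ∈ v \ u, (1 - (glue u y t j : ℝ))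

lemma abs_one_sub_coe_le (t : I) : |1 - (t : ℝ)| ≤ 1 := by
  rw [abs_le]; constructor <;> linarith [t.2.1, t.2.2]

lemma measurable_prod_one_sub (w : Finset (Fin s)) :
    Measurable fun z : Fin s → I => ∏ j ∈ w, (1 - (z j : ℝ)) :=
  Finset.measurable_prod _ fun j _ => measurable_const.sub
    (measurable_subtype_coe.comp (measurable_pi_apply j))

lemma abs_prod_one_sub_le (w : Finset (Fin s)) (z : Fin s → I) :
    ‖∏ j ∈ w, (1 - (z j : ℝ))‖ ≤ 1 := by
  rw [Real.norm_eq_abs, Finset.abs_prod]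
  exact Finset.prod_le_one (fun _ _ => abs_nonneg _) fun _ _ => abs_one_sub_coe_le _

lemma aestronglyMeasurable_mul_prod_one_sub {H : (Fin s → I) → ℝ} (hH : AEStronglyMeasurable H)
    (w : Finset (Fin s)) : AEStronglyMeasurable fun z => H z * ∏ j ∈ w, (1 - (z j : ℝ)) :=
  hH.mul (measurable_prod_one_sub w).aestronglyMeasurable

lemma integrable_mul_prod_one_sub {H : (Fin s → I) → ℝ} (hH : Integrable H)
    (w : Finset (Fin s)) : Integrable fun z => H z * ∏ j ∈ w, (1 - (z j : ℝ)) :=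
  hH.mul_bdd (measurable_prod_one_sub w).aestronglyMeasurable
    (ae_of_all _ fun z => abs_prod_one_sub_le w z)

lemma memLp_anovaDensity (u v : Finset (Fin s)) {h : (v → I) → ℝ} {p : ℝ} (hp : 1 ≤ p)
    (hh : MemLp h (ENNReal.ofReal p)) : MemLp (anovaDensity u v h) (ENNReal.ofReal p) := by
  have hg := measurePreserving_glue u
  have hH : MemLp (extendVars v h) (ENNReal.ofReal p) :=
    hh.comp_measurePreserving (measurePreserving_restrictVars v)
  have hK := aestronglyMeasurable_mul_prod_one_sub hH.1 (v \ u)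
  have hKg := hK.comp_measurePreserving hg
  refine ⟨hKg.integral_prod_right', ?_⟩
  refine (eLpNorm_integral_prod_right_le hKg hp).trans_lt ?_
  have e := eLpNorm_comp_measurePreserving (p := ENNReal.ofReal p) hK hg
  refine (e.trans_le ?_).trans_lt hH.2
  refine eLpNorm_mono fun z => ?_
  rw [norm_mul]
  exact mul_le_of_le_one_right (norm_nonneg _) (abs_prod_one_sub_le _ _)

/-- The kernel `1_{[0,x)}(t) - (1 - t)` of the ANOVA decomposition. -/
noncomputable def anovaKernel (x t : I) : ℝ := stepKernel x t - (1 - (t : ℝ))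

lemma measurable_anovaKernel (x : I) : Measurable (anovaKernel x) :=
  (measurable_stepKernel.comp (f := fun t : I => (x, t))
    (measurable_const.prodMk measurable_id)).sub (measurable_const.sub measurable_subtype_coe)

lemma abs_anovaKernel_le (x t : I) : |anovaKernel x t| ≤ 1 := by
  rw [anovaKernel, abs_le, stepKernel_eq]
  split_ifs <;> constructor <;> linarith [t.2.1, t.2.2]

lemma measurable_prod_anovaKernel {ι : Type} (w : Finset ι) (x : ι → I) :
    Measurable fun z : ι → I => ∏ j ∈ w, anovaKernel (x j) (z j) :=
  Finset.measurable_prod _ fun j _ => (measurable_anovaKernel _).comp (measurable_pi_apply j)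

lemma abs_prod_anovaKernel_le {ι : Type} (w : Finset ι) (x z : ι → I) :
    ‖∏ j ∈ w, anovaKernel (x j) (z j)‖ ≤ 1 := by
  rw [Real.norm_eq_abs, Finset.abs_prod]
  exact Finset.prod_le_one (fun _ _ => abs_nonneg _) fun _ _ => abs_anovaKernel_le _ _

lemma integrable_anova_term {H : (Fin s → I) → ℝ} (hH : Integrable H) (u v : Finset (Fin s))
    (x : Fin s → I) : Integrable fun z => H z * (∏ j ∈ v \ u, (1 - (z j : ℝ))) *
      ∏ j ∈ u, anovaKernel (x j) (z j) :=
  (integrable_mul_prod_one_sub hH _).mul_bdd (measurable_prod_anovaKernel u x).aestronglyMeasurable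
    (ae_of_all _ fun z => abs_prod_anovaKernel_le u x z)

/-- Fubini merges the integrals over `D^u` and `D^{uᶜ}` into one over the whole cube, so the terms
for different `u` can be added under a single integral. -/
lemma anovaOp_anovaDensity (u v : Finset (Fin s)) {h : (v → I) → ℝ} (hh : Integrable h)
    (x : Fin s → I) :
    anovaOp u (anovaDensity u v h) x =
      ∫ z, extendVars v h z * (∏ j ∈ v \ u, (1 - (z j : ℝ))) *
        ∏ j ∈ u, anovaKernel (x j) (z j) := by
  have hg := measurePreserving_glue u
  have hi := integrable_anova_term (integrable_extendVars hh) u v x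
  rw [← hg.map_eq, integral_map hg.measurable.aemeasurable (by rw [hg.map_eq]; exact hi.1)]
  refine Eq.trans ?_ (integral_prod _ (hg.integrable_comp_of_integrable hi)).symm
  refine integral_congr_ae (ae_of_all _ fun y => ?_)
  simp only [anovaDensity, Function.comp_def]
  rw [← integral_mul_const]
  refine integral_congr_ae (ae_of_all _ fun t => ?_)
  simp only
  congr 1
  rw [← Finset.prod_coe_sort u]
  refine Finset.prod_congr rfl fun j _ => ?_
  simp [anovaKernel, stepKernel, glue]

lemma integrable_anovaDensity (u v : Finset (Fin s)) {h : (v → I) → ℝ} (hh : Integrable h) :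
    Integrable (anovaDensity u v h) := by
  have := memLp_anovaDensity u v (p := 1) le_rfl (h := h) (by simpa [memLp_one_iff_integrable])
  simpa [memLp_one_iff_integrable] using this

/-- Expand `∏_{j ∈ v} (anovaKernel + (1 - t_j))` over the subsets `u` of coordinates where the ANOVA
kernel is chosen. -/
lemma anchoredOp_eq_sum_anovaOp (v : Finset (Fin s)) {h : (v → I) → ℝ} (hh : Integrable h)
    (x : Fin s → I) :
    anchoredOp v h x = ∑ u ∈ v.powerset, anovaOp u (anovaDensity u v h) x := by
  simp only [anovaOp_anovaDensity _ _ hh]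
  rw [← integral_finsetSum _ fun u _ => integrable_anova_term (integrable_extendVars hh) u v x,
    anchoredOp_eq_partialInt v hh.1]
  refine integral_congr_ae (ae_of_all _ fun z => ?_)
  simp only [Finset.piecewise_empty, Finset.sdiff_empty, mul_assoc]
  rw [← Finset.mul_sum]
  congr 1
  have : ∀ j, stepKernel (x j) (z j) = anovaKernel (x j) (z j) + (1 - (z j : ℝ)) := fun j => by
    simp [anovaKernel]
  simp only [this]
  rw [Finset.prod_add]
  exact Finset.sum_congr rfl fun u _ => mul_comm _ _

lemma anovaOp_sum {α : Type} (A : Finset α) (g : α → (u → I) → ℝ)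
    (hg : ∀ a ∈ A, Integrable (g a)) (x : Fin s → I) :
    anovaOp u (fun y => ∑ a ∈ A, g a y) x = ∑ a ∈ A, anovaOp u (g a) x := by
  simp only [anovaOp, Finset.sum_mul]
  refine integral_finsetSum _ fun a ha => ?_
  exact (hg a ha).mul_bdd (c := 1)
    (measurable_prod_anovaKernel Finset.univ fun j : u => x j).aestronglyMeasurable
    (ae_of_all _ fun z => abs_prod_anovaKernel_le Finset.univ (fun j : u => x j) z)

/-- The anchored space is contained in the ANOVA space if the positive weights form a downward
closed family. -/
theorem anchoredSpace_subset_anovaSpace {p : ℝ} (hp : 1 ≤ p) {γ : Finset (Fin s) → ℝ≥0}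
    (hγ : ∀ u v, u ⊆ v → 0 < γ v → 0 < γ u) : anchoredSpace p γ ⊆ anovaSpace p γ := by
  rintro f ⟨h, hh, hf⟩
  have hi : ∀ v, Integrable (h v) := fun v => (hh v).integrable (by simpa using hp)
  refine ⟨fun u y => ∑ v with 0 < γ v ∧ u ⊆ v, anovaDensity u v (h v) y, fun u => ?_, fun x => ?_⟩
  · exact memLp_finsetSum _ fun v _ => memLp_anovaDensity u v hp (hh v)
  · rw [hf]
    simp only [anchoredOp_eq_sum_anovaOp _ (hi _),
      anovaOp_sum _ _ fun v _ => integrable_anovaDensity _ v (hi v)]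
    -- Downward closedness ensures that every `u ⊆ v` produced by the expansion has positive weight.
    refine Finset.sum_comm' fun v u => ?_
    simp only [Finset.mem_filter, Finset.mem_univ, true_and, Finset.mem_powerset]
    exact ⟨fun ⟨h1, h2⟩ => ⟨⟨h1, h2⟩, hγ _ _ h2 h1⟩, fun ⟨⟨h1, h2⟩, _⟩ => ⟨h1, h2⟩⟩

end Inclusion

end WeightedSpaces

/-! ### Upper bound for the embedding norm -/

namespace WeightedSpaces

variable {s q : ℕ} {ω : ℝ≥0} {p : ℝ}

lemma finiteOrderWeights_pos_iff (hω : 0 < ω) (u : Finset (Fin s)) :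
    0 < finiteOrderWeights ω q s u ↔ u.card ≤ q := by
  rw [finiteOrderWeights]
  split_ifs with h
  · simp [h, pow_pos hω]
  · simp [h]

lemma finiteOrderWeights_pos_mono (hω : 0 < ω) (u v : Finset (Fin s)) (huv : u ⊆ v)
    (hv : 0 < finiteOrderWeights ω q s v) : 0 < finiteOrderWeights ω q s u := by
  rw [finiteOrderWeights_pos_iff hω] at *
  exact (Finset.card_le_card huv).trans hv

/-- Compare `∑_{k ≤ q} C(s,k)` termwise with the binomial expansion of `(s+1)^q`, using `C(s,k) ≤
s^k`. -/
lemma card_filter_card_le (s q : ℕ) :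
    (Finset.univ.filter fun u : Finset (Fin s) => u.card ≤ q).card ≤ (s + 1) ^ q := by
  have h1 : (Finset.univ.filter fun u : Finset (Fin s) => u.card ≤ q) ⊆
      (Finset.range (q + 1)).biUnion fun k => Finset.powersetCard k Finset.univ := by
    intro u hu
    simp only [Finset.mem_filter, Finset.mem_univ, true_and] at hu
    simp only [Finset.mem_biUnion, Finset.mem_range, Finset.mem_powersetCard]
    exact ⟨u.card, by omega, Finset.subset_univ _, rfl⟩
  refine (Finset.card_le_card h1).trans (Finset.card_biUnion_le.trans ?_)
  rw [add_pow]
  refine Finset.sum_le_sum fun k hk => ?_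
  rw [Finset.card_powersetCard, Finset.card_univ, Fintype.card_fin, one_pow, mul_one]
  refine (Nat.choose_le_pow s k).trans (Nat.le_mul_of_pos_right _ (Nat.choose_pos ?_))
  exact Nat.lt_succ_iff.1 (Finset.mem_range.1 hk)

/-- Along inclusions the finite order weights grow at most by a constant factor. -/
lemma finiteOrderWeights_rpow_neg_le (hp : 0 < p) {u v : Finset (Fin s)}
    (huv : u ⊆ v) (hv : v.card ≤ q) :
    (finiteOrderWeights ω q s u : ℝ≥0∞) ^ (-p) ≤
      (((max 1 ω) ^ q : ℝ≥0) : ℝ≥0∞) ^ p * (finiteOrderWeights ω q s v : ℝ≥0∞) ^ (-p) := by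
  have hu : u.card ≤ q := (Finset.card_le_card huv).trans hv
  -- The ratio `γ_v / γ_u` is `ω^(|v| - |u|)` with exponent at most `q`; the maximum with `1` covers
  -- both `ω ≤ 1` and `ω > 1`.
  have hM : finiteOrderWeights ω q s v ≤ (max 1 ω) ^ q * finiteOrderWeights ω q s u := by
    simp only [finiteOrderWeights, hu, hv, if_true]
    rw [← Nat.sub_add_cancel (Finset.card_le_card huv), pow_add]
    refine mul_le_mul_left ?_ _
    calc ω ^ (v.card - u.card) ≤ (max 1 ω) ^ (v.card - u.card) :=
          pow_le_pow_left₀ zero_le (le_max_right _ _) _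
      _ ≤ (max 1 ω) ^ q := pow_le_pow_right₀ (le_max_left _ _) (by omega)
  have hM' : (finiteOrderWeights ω q s v : ℝ≥0∞) ≤
      (((max 1 ω) ^ q : ℝ≥0) : ℝ≥0∞) * (finiteOrderWeights ω q s u : ℝ≥0∞) := by exact_mod_cast hM
  set M : ℝ≥0 := (max 1 ω) ^ q with hMdef
  have hM0 : (M : ℝ≥0∞) ≠ 0 := by
    have : (0 : ℝ≥0) < M := pow_pos (lt_max_of_lt_left one_pos) _
    exact_mod_cast this.ne'
  have h2 := ENNReal.rpow_le_rpow hM' hp.le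
  rw [ENNReal.mul_rpow_of_nonneg _ _ hp.le] at h2
  have hMp0 : (M : ℝ≥0∞) ^ p ≠ 0 := by simp [hp.not_gt, hM0]
  have hMpt : (M : ℝ≥0∞) ^ p ≠ ∞ := ENNReal.rpow_ne_top_of_nonneg hp.le ENNReal.coe_ne_top
  rw [ENNReal.rpow_neg, ENNReal.rpow_neg]
  calc ((finiteOrderWeights ω q s u : ℝ≥0∞) ^ p)⁻¹
      = (M : ℝ≥0∞) ^ p *
          ((M : ℝ≥0∞) ^ p * (finiteOrderWeights ω q s u : ℝ≥0∞) ^ p)⁻¹ := by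
        rw [ENNReal.mul_inv (Or.inl hMp0) (Or.inl hMpt), ← mul_assoc,
          ENNReal.mul_inv_cancel hMp0 hMpt, one_mul]
    _ ≤ _ := by gcongr

lemma anovaNorm_le (hp : 1 < p) (hω : 0 < ω) {f : (Fin s → I) → ℝ}
    (hf : f ∈ anchoredSpace p (finiteOrderWeights ω q s))
    (hf1 : anchoredNorm p (finiteOrderWeights ω q s) f ≤ 1) :
    anovaNorm p (finiteOrderWeights ω q s) f ≤
      ((((s + 1) ^ q : ℕ) : ℝ≥0∞) ^ (p - 1) *
        ((((max 1 ω) ^ q : ℝ≥0) : ℝ≥0∞) ^ p * 2 ^ q)) ^ (1 / p) := by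
  have hp0 : 0 < p := by linarith
  obtain ⟨h, hh, hfh⟩ := hf
  have hi : ∀ v, Integrable (h v) := fun v => (hh v).integrable (by simpa using hp.le)
  set γ := finiteOrderWeights ω q s with hγ
  set U : Finset (Finset (Fin s)) := Finset.univ.filter fun u => 0 < γ u with hU
  have hUmem : ∀ u, u ∈ U ↔ u.card ≤ q := fun u => by
    simp [hU, hγ, finiteOrderWeights_pos_iff hω]
  set a : Finset (Fin s) → ℝ≥0∞ := fun v => eLpNorm (h v) (ENNReal.ofReal p) volume with ha
  set M : ℝ≥0∞ := (((max 1 ω) ^ q : ℝ≥0) : ℝ≥0∞) with hM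
  set N : ℝ≥0∞ := (((s + 1) ^ q : ℕ) : ℝ≥0∞) with hN
  have hb : ∑ v ∈ U, (γ v : ℝ≥0∞) ^ (-p) * a v ^ p ≤ 1 := by
    have h1 : ∑ v ∈ U, (γ v : ℝ≥0∞) ^ (-p) * a v ^ p = ∑ v ∈ U, (γ v : ℝ≥0∞) ^ (-p) *
        eLpNorm (anchoredDeriv f v) (ENNReal.ofReal p) volume ^ p :=
      Finset.sum_congr rfl fun v hv => by
        rw [eLpNorm_congr_ae (anchoredDeriv_ae_eq hi hfh hv)]
    rw [h1]
    have h2 := ENNReal.rpow_le_rpow hf1 hp0.le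
    rwa [anchoredNorm, ← ENNReal.rpow_mul, one_div, inv_mul_cancel₀ hp0.ne', ENNReal.rpow_one,
      ENNReal.one_rpow] at h2
  refine ENNReal.rpow_le_rpow ?_ (by positivity)
  have hcard : ∀ u, ((U.filter fun v => u ⊆ v).card : ℝ≥0∞) ≤ N := by
    intro u
    have h1 : (U.filter fun v => u ⊆ v).card ≤ (s + 1) ^ q := by
      refine (Finset.card_le_card fun v hv => ?_).trans (card_filter_card_le s q)
      simpa [hUmem] using (Finset.mem_filter.1 hv).1
    exact Nat.cast_le.2 h1
  calc ∑ u ∈ U, (γ u : ℝ≥0∞) ^ (-p) * eLpNorm (anovaDeriv f u) (ENNReal.ofReal p) volume ^ p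
      ≤ ∑ u ∈ U, ∑ v ∈ U with u ⊆ v, N ^ (p - 1) * (M ^ p * ((γ v : ℝ≥0∞) ^ (-p) * a v ^ p)) := by
        refine Finset.sum_le_sum fun u _ => ?_
        -- The power mean inequality over at most `N` sets; its factor `N^(p-1)` is the source of
        -- the growth in `s`.
        have h1 : eLpNorm (anovaDeriv f u) (ENNReal.ofReal p) volume ^ p ≤
            N ^ (p - 1) * ∑ v ∈ U with u ⊆ v, a v ^ p := by
          refine (ENNReal.rpow_le_rpow (eLpNorm_anovaDeriv_le hi hfh u hp.le) hp0.le).trans ?_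
          refine (ENNReal.rpow_sum_le_const_mul_sum_rpow _ _ hp.le).trans ?_
          exact mul_le_mul_left (ENNReal.rpow_le_rpow (hcard u) (by linarith)) _
        refine (mul_le_mul_right h1 _).trans ?_
        rw [mul_left_comm, ← Finset.mul_sum, Finset.mul_sum]
        refine mul_le_mul_right (Finset.sum_le_sum fun v hv => ?_) _
        rw [← mul_assoc]
        refine mul_le_mul_left ?_ _
        have hv' := Finset.mem_filter.1 hv
        exact finiteOrderWeights_rpow_neg_le hp0 hv'.2 ((hUmem v).1 hv'.1)
    -- After the exchange the summand no longer depends on `u`, and each `v` has at most `2^q`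
    -- subsets.
    _ = ∑ v ∈ U, ∑ u ∈ U with u ⊆ v, N ^ (p - 1) * (M ^ p * ((γ v : ℝ≥0∞) ^ (-p) * a v ^ p)) := by
        refine Finset.sum_comm' fun u v => ?_
        simp only [Finset.mem_filter]
        tauto
    _ ≤ ∑ v ∈ U, 2 ^ q * (N ^ (p - 1) * (M ^ p * ((γ v : ℝ≥0∞) ^ (-p) * a v ^ p))) := by
        refine Finset.sum_le_sum fun v hv => ?_
        rw [Finset.sum_const, nsmul_eq_mul]
        gcongr
        have h1 : (U.filter fun u => u ⊆ v).card ≤ 2 ^ q := by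
          calc (U.filter fun u => u ⊆ v).card ≤ v.powerset.card :=
                Finset.card_le_card fun u hu => Finset.mem_powerset.2 (Finset.mem_filter.1 hu).2
            _ = 2 ^ v.card := Finset.card_powerset v
            _ ≤ 2 ^ q := Nat.pow_le_pow_right (by norm_num) ((hUmem v).1 hv)
        exact_mod_cast h1
    _ = N ^ (p - 1) * (M ^ p * 2 ^ q) * ∑ v ∈ U, (γ v : ℝ≥0∞) ^ (-p) * a v ^ p := by
        rw [Finset.mul_sum]
        exact Finset.sum_congr rfl fun v _ => by ring
    _ ≤ N ^ (p - 1) * (M ^ p * 2 ^ q) := by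
        simpa using mul_le_mul_right hb (N ^ (p - 1) * (M ^ p * 2 ^ q))

lemma embeddingNorm_le (hp : 1 < p) (hω : 0 < ω) (q s : ℕ) :
    embeddingNorm p (finiteOrderWeights ω q s) ≤
      ((((s + 1) ^ q : ℕ) : ℝ≥0∞) ^ (p - 1) *
        ((((max 1 ω) ^ q : ℝ≥0) : ℝ≥0∞) ^ p * 2 ^ q)) ^ (1 / p) :=
  iSup₂_le fun _ hf => anovaNorm_le hp hω hf.1 hf.2

lemma embeddingNorm_ne_top (hp : 1 < p) (hω : 0 < ω) (q s : ℕ) :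
    embeddingNorm p (finiteOrderWeights ω q s) ≠ ∞ := by
  have hp0 : 0 < p := by linarith
  refine ne_top_of_le_ne_top ?_ (embeddingNorm_le hp hω q s)
  refine ENNReal.rpow_ne_top_of_nonneg (by positivity) (ENNReal.mul_ne_top ?_
    (ENNReal.mul_ne_top ?_ (ENNReal.pow_ne_top (by simp))))
  · exact ENNReal.rpow_ne_top_of_nonneg (by linarith) (ENNReal.natCast_ne_top _)
  · exact ENNReal.rpow_ne_top_of_nonneg hp0.le ENNReal.coe_ne_top

lemma toReal_embeddingNorm_le (hp : 1 < p) (hω : 0 < ω) (q s : ℕ) :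
    (embeddingNorm p (finiteOrderWeights ω q s)).toReal ≤
      (((max 1 ω : ℝ≥0) : ℝ) ^ q * (2 ^ q) ^ (1 / p)) * (((s : ℝ) + 1) ^ q) ^ ((p - 1) / p) := by
  have hp0 : 0 < p := by linarith
  have h0 : (0 : ℝ) ≤ ((max 1 ω : ℝ≥0) : ℝ) ^ q := by positivity
  have hs : (0 : ℝ) ≤ ((s : ℝ) + 1) ^ q := by positivity
  have h1 := ENNReal.toReal_mono ?_ (embeddingNorm_le hp hω q s)
  · refine h1.trans_eq ?_
    rw [← ENNReal.toReal_rpow, ENNReal.toReal_mul, ENNReal.toReal_mul, ← ENNReal.toReal_rpow,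
      ← ENNReal.toReal_rpow, ENNReal.toReal_natCast, ENNReal.toReal_pow, ENNReal.coe_toReal,
      ENNReal.toReal_ofNat]
    push_cast [NNReal.coe_pow]
    rw [Real.mul_rpow (by positivity) (by positivity), Real.mul_rpow (by positivity) (by positivity),
      ← Real.rpow_mul hs, ← Real.rpow_mul (by positivity : (0:ℝ) ≤ (max 1 (ω : ℝ)) ^ q),
      mul_one_div_cancel hp0.ne', Real.rpow_one, mul_one_div]
    ring
  · refine ENNReal.rpow_ne_top_of_nonneg (by positivity) (ENNReal.mul_ne_top ?_
      (ENNReal.mul_ne_top ?_ (ENNReal.pow_ne_top (by simp))))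
    · exact ENNReal.rpow_ne_top_of_nonneg (by linarith) (ENNReal.natCast_ne_top _)
    · exact ENNReal.rpow_ne_top_of_nonneg hp0.le ENNReal.coe_ne_top

/-! ### Lower bound for the embedding norm -/

section LowerBound

lemma integral_stepKernel (x : I) : ∫ t : I, stepKernel x t = x := by
  have h : (fun t : I => stepKernel x t) = (Set.Iio x).indicator fun _ => (1 : ℝ) := by
    funext t
    simp [stepKernel_eq, Set.indicator_apply]
  rw [h, integral_indicator measurableSet_Iio]
  simp [Measure.real, x.2.1]

lemma integral_coe_unitInterval : ∫ t : I, (t : ℝ) = 1 / 2 := by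
  rw [integral_subtype (measurableSet_Icc : MeasurableSet I) (fun r : ℝ => r),
    integral_Icc_eq_integral_Ioc, ← intervalIntegral.integral_of_le zero_le_one, integral_id]
  norm_num

lemma anchoredOp_const (u : Finset (Fin s)) (c : ℝ) (x : Fin s → I) :
    anchoredOp u (fun _ => c) x = c * ∏ j : u, (x j : ℝ) := by
  simp only [anchoredOp]
  rw [integral_const_mul, integral_fintype_prod_volume_eq_prod
    (f := fun (j : u) (t : I) => (Set.Ico (0 : I) (x j)).indicator (fun _ => (1 : ℝ)) t)]
  congr 1
  exact Finset.prod_congr rfl fun j _ => integral_stepKernel _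

lemma integral_anchoredOp_const (u : Finset (Fin s)) (c : ℝ) :
    ∫ x, anchoredOp u (fun _ => c) x = c * (1 / 2) ^ u.card := by
  simp only [anchoredOp_const]
  rw [integral_const_mul]
  congr 1
  have hmp := measurePreserving_restrictVars u
  have hm : Measurable fun y : u → I => ∏ j : u, (y j : ℝ) :=
    Finset.measurable_prod _ fun j _ => measurable_subtype_coe.comp (measurable_pi_apply j)
  have h := integral_map (μ := volume) hmp.measurable.aemeasurable (f := fun y : u → I => ∏ j : u, (y j : ℝ))
    hm.aestronglyMeasurable
  rw [hmp.map_eq, integral_fintype_prod_volume_eq_prod (f := fun (_ : u) (t : I) => (t : ℝ))] at h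
  rw [← h]
  simp [integral_coe_unitInterval]

/-- The extremal candidate spreads its mass equally over all `u` with `|u| = q`. Each component is a
multiple of `∏_{j ∈ u} x_j`, with mean `2^(-q)`, so the means add up without cancellation. -/
lemma le_toReal_embeddingNorm (hp : 1 < p) (hω : 0 < ω) {q s : ℕ} (hqs : q ≤ s) :
    ((ω : ℝ) / 2) ^ q * (s.choose q : ℝ) ^ ((p - 1) / p) ≤
      (embeddingNorm p (finiteOrderWeights ω q s)).toReal := by
  have hp0 : 0 < p := by linarith
  set γ := finiteOrderWeights ω q s with hγ
  set U : Finset (Finset (Fin s)) := Finset.univ.filter fun u => 0 < γ u with hU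
  have hUmem : ∀ u, u ∈ U ↔ u.card ≤ q := fun u => by
    simp [hU, hγ, finiteOrderWeights_pos_iff hω]
  set C : ℝ≥0 := (s.choose q : ℝ≥0) with hC
  have hC0 : 0 < C := by
    have := Nat.choose_pos hqs
    simpa [hC] using this
  -- Normalisation: each of the `C` sets of size `q` contributes `γ_u^(-p) c^p = 1/C`, so the
  -- anchored norm is `1`.
  set c : ℝ≥0 := ω ^ q * C ^ (-(1 / p)) with hc
  set h : (u : Finset (Fin s)) → (u → I) → ℝ := fun u _ => if u.card = q then (c : ℝ) else 0
    with hh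
  set f : (Fin s → I) → ℝ := fun x => ∑ u ∈ U, anchoredOp u (h u) x with hf
  have hLp : ∀ u, MemLp (h u) (ENNReal.ofReal p) volume := fun u => memLp_const _
  have hi : ∀ u, Integrable (h u) := fun u => integrable_const _
  have hfU : U.filter (fun u => u.card = q) = Finset.powersetCard q Finset.univ := by
    ext u
    simp only [Finset.mem_filter, hUmem, Finset.mem_powersetCard, Finset.subset_univ, true_and]
    exact ⟨fun h => h.2, fun h => ⟨h.le, h⟩⟩
  have hfU' : (U.filter fun u => u.card = q).card = s.choose q := by
    rw [hfU, Finset.card_powersetCard, Finset.card_univ, Fintype.card_fin]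
  have hfs : f ∈ anchoredSpace p γ := ⟨h, hLp, fun x => rfl⟩
  have hpne : ENNReal.ofReal p ≠ 0 := by simpa using hp0
  have hn : anchoredNorm p γ f ≤ 1 := by
    rw [anchoredNorm]
    have h1 : ∑ u ∈ U, (γ u : ℝ≥0∞) ^ (-p) *
        eLpNorm (anchoredDeriv f u) (ENNReal.ofReal p) volume ^ p =
        ∑ u ∈ U, if u.card = q then ((C⁻¹ : ℝ≥0) : ℝ≥0∞) else 0 := by
      refine Finset.sum_congr rfl fun u hu => ?_
      rw [eLpNorm_congr_ae (anchoredDeriv_ae_eq hi (fun x => rfl) hu)]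
      simp only [hh]
      rw [eLpNorm_const _ hpne (NeZero.ne _)]
      split_ifs with huq
      · have hγu : γ u = ω ^ q := by simp [hγ, finiteOrderWeights, huq]
        have hωq : ω ^ q ≠ 0 := (pow_pos hω q).ne'
        have hcp : c ^ p = (ω ^ q) ^ p * C⁻¹ := by
          rw [hc, NNReal.mul_rpow, ← NNReal.rpow_mul, neg_mul, one_div_mul_cancel hp0.ne',
            NNReal.rpow_neg_one]
        rw [hγu, measure_univ, ENNReal.one_rpow, mul_one, Real.enorm_eq_ofReal c.coe_nonneg,
          ENNReal.ofReal_coe_nnreal, ← ENNReal.coe_rpow_of_ne_zero hωq,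
          ← ENNReal.coe_rpow_of_nonneg _ hp0.le, ← ENNReal.coe_mul, hcp, ← mul_assoc,
          ← NNReal.rpow_add hωq, neg_add_cancel, NNReal.rpow_zero, one_mul]
      · simp [hp0]
    rw [h1, ← Finset.sum_filter, Finset.sum_const, hfU', nsmul_eq_mul]
    have h2 : ((s.choose q : ℕ) : ℝ≥0∞) * ((C⁻¹ : ℝ≥0) : ℝ≥0∞) = 1 := by
      have : ((s.choose q : ℕ) : ℝ≥0∞) = (C : ℝ≥0∞) := by simp [hC]
      rw [this, ← ENNReal.coe_mul, mul_inv_cancel₀ hC0.ne', ENNReal.coe_one]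
    rw [h2, ENNReal.one_rpow]
  have hfi : Integrable f := (isWeakMixedDeriv_anchored hi (fun x => rfl) ∅).1
  have hint : ∫ x, f x = ((ω : ℝ) / 2) ^ q * (s.choose q : ℝ) ^ ((p - 1) / p) := by
    have h1 : ∫ x, f x = ∑ u ∈ U, if u.card = q then (c : ℝ) * (1 / 2) ^ q else 0 := by
      rw [hf, integral_finsetSum _ fun u _ => (isWeakMixedDeriv_anchoredOp (u := ∅) (hi u)).1]
      refine Finset.sum_congr rfl fun u _ => ?_
      rw [hh, integral_anchoredOp_const]
      split_ifs with huq
      · rw [huq]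
      · simp
    have hCr : (C : ℝ) = (s.choose q : ℝ) := by simp [hC]
    have hC0' : (0 : ℝ) < C := hC0
    rw [h1, ← Finset.sum_filter, Finset.sum_const, hfU', nsmul_eq_mul, hc, ← hCr]
    -- Summing `C` equal terms of size `C^(-1/p)` produces the exponent `1 - 1/p = 1/p*`.
    have h2 : (C : ℝ) ^ ((p - 1) / p) = C * (C : ℝ) ^ (-(1 / p)) := by
      rw [← Real.rpow_one_add' hC0'.le]
      · congr 1
        field_simp
        ring
      · have : 1 / p < 1 := by rw [div_lt_one hp0]; exact hp
        linarith
    rw [h2, div_pow]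
    push_cast
    rw [div_pow, one_pow]
    ring
  have hle : ‖∫ x, f x‖ₑ ≤ embeddingNorm p γ := by
    -- Test the supremum with `f` and keep only the term `u = ∅`, whose weight is `1`.
    refine le_trans ?_ (le_iSup₂_of_le f ⟨hfs, hn⟩ le_rfl)
    rw [anovaNorm]
    have hmem : (∅ : Finset (Fin s)) ∈ U := by simp [hUmem]
    have h1 := Finset.single_le_sum (s := U) (f := fun u => (γ u : ℝ≥0∞) ^ (-p) *
      eLpNorm (anovaDeriv f u) (ENNReal.ofReal p) volume ^ p) (fun _ _ => zero_le) hmem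
    refine le_trans ?_ (ENNReal.rpow_le_rpow h1 (by positivity))
    have hγ0 : γ ∅ = 1 := by simp [hγ, finiteOrderWeights]
    simp only [hγ0, ENNReal.coe_one, ENNReal.one_rpow, one_mul]
    rw [← ENNReal.rpow_mul, mul_one_div_cancel hp0.ne', ENNReal.rpow_one]
    exact enorm_integral_le_eLpNorm_anovaDeriv_empty hfi hp.le
  have := ENNReal.toReal_mono (embeddingNorm_ne_top hp hω q s) hle
  rw [toReal_enorm, hint, Real.norm_of_nonneg (by positivity)] at this
  exact this

end LowerBound

end WeightedSpaces

/-! ### The asymptotic statement -/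

theorem mainTheorem2 (p : ℝ) (hp : 1 < p) (q : ℕ) (ω : ℝ≥0) (hω : 0 < ω) :
    (∀ s : ℕ,
      WeightedSpaces.anchoredSpace p (WeightedSpaces.finiteOrderWeights ω q s) ⊆
        WeightedSpaces.anovaSpace p (WeightedSpaces.finiteOrderWeights ω q s)) ∧
    (∀ s : ℕ, WeightedSpaces.embeddingNorm p (WeightedSpaces.finiteOrderWeights ω q s) ≠ ∞) ∧
    (fun s : ℕ =>
        (WeightedSpaces.embeddingNorm p (WeightedSpaces.finiteOrderWeights ω q s)).toReal)
      =Θ[atTop] fun s : ℕ => (s : ℝ) ^ ((q : ℝ) / p.conjExponent) := by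
  have hp0 : 0 < p := by linarith
  have hr : 0 ≤ (p - 1) / p := div_nonneg (by linarith) hp0.le
  have hexp : ∀ s : ℕ, (s : ℝ) ^ ((q : ℝ) / p.conjExponent) = ((s : ℝ) ^ q) ^ ((p - 1) / p) := by
    intro s
    rw [← Real.rpow_natCast (s : ℝ) q, ← Real.rpow_mul (by positivity), Real.conjExponent]
    congr 1
    rw [div_div_eq_mul_div, mul_div_assoc]
  refine ⟨fun s => WeightedSpaces.anchoredSpace_subset_anovaSpace hp.le
      (WeightedSpaces.finiteOrderWeights_pos_mono hω),
    WeightedSpaces.embeddingNorm_ne_top hp hω q, ?_, ?_⟩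
  · refine Asymptotics.IsBigO.of_bound
      ((((max 1 ω : ℝ≥0) : ℝ) ^ q * (2 ^ q) ^ (1 / p)) * (2 ^ q) ^ ((p - 1) / p)) ?_
    -- For `s ≥ 1` one has `s + 1 ≤ 2s`, which accounts for the factor `(2^q)^((p-1)/p)`.
    filter_upwards [eventually_ge_atTop 1] with s hs
    rw [hexp, Real.norm_of_nonneg ENNReal.toReal_nonneg, Real.norm_of_nonneg (by positivity),
      mul_assoc, ← Real.mul_rpow (by positivity) (by positivity), ← mul_pow]
    refine (WeightedSpaces.toReal_embeddingNorm_le hp hω q s).trans ?_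
    have hs' : (1 : ℝ) ≤ s := by exact_mod_cast hs
    gcongr
    linarith
  · have hκ : (0 : ℝ) < ((ω : ℝ) / 2) ^ q * ((1 / 2) ^ q / q.factorial) ^ ((p - 1) / p) := by
      have : (0 : ℝ) < ω := hω
      positivity
    refine Asymptotics.IsBigO.of_bound
      (((ω : ℝ) / 2) ^ q * ((1 / 2) ^ q / q.factorial) ^ ((p - 1) / p))⁻¹ ?_
    -- For `s ≥ 2q` one has `s + 1 - q ≥ s/2`, hence `C(s,q) ≥ (s + 1 - q)^q / q! ≥ (s/2)^q / q!`.
    filter_upwards [eventually_ge_atTop (2 * q)] with s hs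
    rw [hexp, Real.norm_of_nonneg ENNReal.toReal_nonneg, Real.norm_of_nonneg (by positivity),
      ← div_eq_inv_mul, le_div_iff₀ hκ]
    refine le_trans ?_ (WeightedSpaces.le_toReal_embeddingNorm hp hω (by omega : q ≤ s))
    rw [mul_left_comm, ← Real.mul_rpow (by positivity) (by positivity)]
    gcongr
    refine le_trans ?_ (Nat.pow_le_choose q s)
    rw [← mul_div_assoc, ← mul_pow]
    gcongr
    have h1 : ((s + 1 - q : ℕ) : ℝ) = s + 1 - q := by
      rw [Nat.cast_sub (by omega)]; push_cast; ring
    have h2 : (2 * q : ℝ) ≤ s := by exact_mod_cast hs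
    rw [h1]
    linarith
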